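/- Let $r\le d$ be natural numbers, $\lambda>0$, and let $K_Y\in\mathbb R^{d\times d}$ be symmetric positive semidefinite (possibly singular), with eigenvalues $\lambda_1(K_Y)\ge\dots\ge\lambda_d(K_Y)$ counted with multiplicity. Let $Y\sim\mathcal N(0,K_Y)$ and $X\sim\mathcal N(0,I_r)$. For probability measures $P,Q$ on $\mathbb R^d$ put $$W_{2,\lambda}^2(P,Q)=\inf_{\pi}\Big\{\mathbb E_{(Z,Y)\sim\pi}\|Z-Y\|^2+\lambda\, I_\pi(Z;Y)\Big\},$$ where $\pi$ ranges over all couplings of $P$ and $Q$, $\|\cdot\|$ is the Euclidean norm, and $I_\pi(Z;Y)=D_{\mathrm{KL}}(\pi\,\|\,P\otimes Q)\in[0,\infty]$ is the mutual information (natural logarithm). Consider the entropic W2GAN problem $$\min_{G\in\mathbb R^{d\times r}}W_{2,\lambda}^2(P_{GX},P_Y).\qquad(*)$$ Then: 1. The minimum in $(*)$ is attained. 2. A matrix $G\in\mathbb R^{d\times r}$ is a minimizer of $(*)$ if and only if the covariance matrix $K_{GX}$ of $GX$ is a soft-thresholded $r$-PCA of $K_Y$, that is: $K_{GX}$ has rank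 at most $r$; there is an orthonormal basis $u_1,\dots,u_d$ of $\mathbb R^d$ such that, for every $i$, $u_i$ is an eigenvector of $K_Y$ for its $i$-th largest eigenvalue and of $K_{GX}$ for its $i$-th largest eigenvalue; and the top $r$ eigenvalues of $K_{GX}$ are $$\sigma_i^2=\big(\lambda_i(K_Y)-\lambda/2\big)_+,\qquad i=1,\dots,r,\qquad (x)_+=\max\{x,0\}.$$ 3. For every minimizer $G$, the rank of $K_{GX}$ equals the number of indices $i\le r$ with $\lambda_i(K_Y)>\lambda/2$; in particular it is exactly $r$ when $\lambda_r(K_Y)>\lambda/2$. -/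

import Mathlib

open MeasureTheory ProbabilityTheory InformationTheory
open scoped ENNReal

/-- The couplings of `P` and `Q`: joint measures with marginals `P` and `Q`. -/
def couplings {E F : Type*} [MeasurableSpace E] [MeasurableSpace F]
    (P : Measure E) (Q : Measure F) : Set (Measure (E × F)) :=
  {π | π.map Prod.fst = P ∧ π.map Prod.snd = Q}

/-- The mutual information (in nats) of the two coordinates under the joint law `π`: the
Kullback-Leibler divergence of `π` from the product of its marginals, with values in `[0, ∞]`. -/
noncomputable def mutualInformation {E F : Type*} [MeasurableSpace E] [MeasurableSpace F]
    (π : Measure (E × F)) : ℝ≥0∞ :=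
  klDiv π ((π.map Prod.fst).prod (π.map Prod.snd))

/-- The entropy-regularized squared 2-Wasserstein distance `W_{2,lam}^2(P, Q)`, the infimum over
all couplings of `E[‖Z - Y‖²] + lam * I(Z; Y)`, with values in `[0, ∞]`. -/
noncomputable def entropicW2Sq {d : ℕ} (lam : ℝ)
    (P Q : Measure (EuclideanSpace ℝ (Fin d))) : ℝ≥0∞ :=
  ⨅ π ∈ couplings P Q,
    (∫⁻ z, ENNReal.ofReal (‖z.1 - z.2‖ ^ 2) ∂π) + ENNReal.ofReal lam * mutualInformation π

/-- The law of `G X` for `X ~ N(0, I_r)` and a linear generator `G ∈ ℝ^{d×r}`. -/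
noncomputable def generatedLaw {d r : ℕ} (G : Matrix (Fin d) (Fin r) ℝ) :
    Measure (EuclideanSpace ℝ (Fin d)) :=
  (stdGaussian (EuclideanSpace ℝ (Fin r))).map (fun x => WithLp.toLp 2 (G.mulVec x.ofLp))

/-- `G` attains the minimum over all matrices `G' ∈ ℝ^{d×r}` of `W_{2,lam}^2(P_{G' X}, P_Y)`. -/
def IsEntropicW2GANMinimizer {d r : ℕ} (lam : ℝ) (PY : Measure (EuclideanSpace ℝ (Fin d)))
    (G : Matrix (Fin d) (Fin r) ℝ) : Prop :=
  ∀ G' : Matrix (Fin d) (Fin r) ℝ,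
    entropicW2Sq lam (generatedLaw G) PY ≤ entropicW2Sq lam (generatedLaw G') PY

/-- The covariance matrix of a law on `ℝ^d`. -/
noncomputable def covarianceMatrix {d : ℕ} (P : Measure (EuclideanSpace ℝ (Fin d))) :
    Matrix (Fin d) (Fin d) ℝ :=
  Matrix.of fun i j => cov[fun x => x i, fun x => x j; P]

theorem covarianceMatrix_isHermitian {d : ℕ} (P : Measure (EuclideanSpace ℝ (Fin d))) :
    (covarianceMatrix P).IsHermitian := by
  ext i j
  simp [covarianceMatrix, covariance_comm]

/-- The eigenvalues of a real symmetric `d × d` matrix with multiplicity, in decreasing order: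
index `i` holds the `(i + 1)`-st largest one. -/
noncomputable def sortedEigenvalue {d : ℕ} {A : Matrix (Fin d) (Fin d) ℝ} (hA : A.IsHermitian)
    (i : Fin d) : ℝ :=
  hA.eigenvalues₀ (Fin.cast (Fintype.card_fin d).symm i)

/-- `L` is an `r`-PCA of `K`, soft-thresholded at level `t`: it has rank at most `r`, some
orthonormal basis consists of eigenvectors of both matrices, each listed for the eigenvalues in
decreasing order, and the top `r` eigenvalues of `L` are `(λ_i(K) - t)_+`. -/
structure IsSoftThresholdedPCA {d : ℕ} (r : ℕ) (t : ℝ) {K L : Matrix (Fin d) (Fin d) ℝ}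
    (hK : K.IsHermitian) (hL : L.IsHermitian) : Prop where
  rank_le : L.rank ≤ r
  eigenvectors : ∃ u : OrthonormalBasis (Fin d) ℝ (EuclideanSpace ℝ (Fin d)),
    (∀ i, K.mulVec (u i).ofLp = sortedEigenvalue hK i • (u i).ofLp) ∧
    (∀ i, L.mulVec (u i).ofLp = sortedEigenvalue hL i • (u i).ofLp)
  eigenvalues : ∀ i : Fin d, i.val < r → sortedEigenvalue hL i = max (sortedEigenvalue hK i - t) 0

/-!
Write `t = lam / 2`, `K` for the covariance matrix of the data and `λ` for its eigenvalues in
decreasing order. The argument is convex duality with an explicit quadratic potential, so that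
neither differential entropies nor a formula for the entropic distance between arbitrary Gaussian
laws is needed.

*Lower bound.* Let `L` be the covariance matrix of the generated law, diagonal with eigenvalues `a`
in an orthonormal basis `f`. The function `φ = dualPotential t f a` is the log-density, with respect
to the product of the marginals, of the law of `(Z, Z + N)` with `Z ~ N(0, L)` and `N ~ N(0, t I)`
independent. Its exponential has mean one under the product of the generated law with any data law,
so the Gibbs variational principle gives `∫ φ dπ ≤ I_π(Z; Y)` for every coupling `π`. Since
`‖z - y‖² + 2 t φ(z, y)` depends on `y` only, its integral is the same for all couplings; it is
`dualValue`, which equals `tr K + ∑ j, scalarCost t (a j) (κ j)` with `κ j` the variance of `Y` in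
the direction `f j` (`IsDiagonalGaussian.dualValue_le_entropicW2Sq`).

*Minimization.* The scalar cost at variance `κ` is at least `-gain t κ`, with equality only at
`a = (κ - t)_+` (`neg_gain_lt_scalarCost`). The gain is nonnegative, nondecreasing and
convex, and strictly increasing and convex above `t`; hence at most `r` orthonormal directions have
total gain at most `∑ i < r, gain t (λ i)` (`sum_gain_le`). So every value of the problem is at
least `optimalValue`.

*Attainment.* If `f` also diagonalizes `K` and `K f j = (a j + t) f j` whenever `a j ≠ 0`, the
exponential of `φ` is normalized in both variables; the product measure tilted by `φ` is then
a coupling, and it attains the dual value (`IsDiagonalGaussian.entropicW2Sq_le_dualValue`). This applies to every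
soft-thresholded PCA.

*Equality.* If a generator attains `optimalValue`, all these inequalities are equalities. Then
`K f j = (a j + t) f j` whenever `a j ≠ 0` (`mulVec_eq_of_dualValue_le`), so `K L = L² + t L` and the
two matrices commute. In a common eigenbasis, replacing a charged direction by an uncharged one of
larger eigenvalue, or adding an uncharged direction above the threshold when fewer than `r` are
charged, would increase the total gain. Hence the two lists of eigenvalues can be sorted
simultaneously, and those of `L` are the soft-thresholded ones
(`isSoftThresholdedPCA_of_entropicW2Sq_le`).
-/

/-! ### The scalar problem -/

/-- The value `t log (1 + a/t) - κ a / (a + t)` that a direction contributes to the dual bound when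
the generated law has variance `a` in it and the data law has variance `κ`. -/
noncomputable def scalarCost (t a κ : ℝ) : ℝ := t * Real.log (1 + a / t) - κ * a / (a + t)

/-- The largest saving in a direction where the data law has variance `x`: it is
`x - t - t log (x/t)` above the threshold `t` and zero below it. -/
noncomputable def gain (t x : ℝ) : ℝ := if t < x then x - t - t * Real.log (x / t) else 0

lemma scalarCost_zero (t κ : ℝ) : scalarCost t 0 κ = 0 := by simp [scalarCost]

lemma gain_of_le {t x : ℝ} (h : x ≤ t) : gain t x = 0 := by simp [gain, h.not_gt]

lemma gain_of_lt {t x : ℝ} (h : t < x) : gain t x = x - t - t * Real.log (x / t) := by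
  simp [gain, h]

lemma gain_nonneg {t : ℝ} (ht : 0 < t) (x : ℝ) : 0 ≤ gain t x := by
  rcases le_or_gt x t with h | h
  · rw [gain_of_le h]
  · rw [gain_of_lt h]
    have h1 := mul_le_mul_of_nonneg_left
      (Real.log_le_sub_one_of_pos (div_pos (ht.trans h) ht)) ht.le
    have h2 : t * (x / t - 1) = x - t := by field_simp
    linarith

lemma gain_le_self {t x : ℝ} (ht : 0 < t) (hx : 0 ≤ x) : gain t x ≤ x := by
  rcases le_or_gt x t with h | h
  · rwa [gain_of_le h]
  · rw [gain_of_lt h]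
    have := mul_nonneg ht.le (Real.log_nonneg ((one_le_div ht).2 h.le))
    linarith

lemma gain_strictMonoOn {t : ℝ} (ht : 0 < t) {x y : ℝ} (hx : t ≤ x) (hxy : x < y) :
    gain t x < gain t y := by
  have hx0 : 0 < x := ht.trans_le hx
  have hy0 : 0 < y := hx0.trans hxy
  have key : gain t x = x - t - t * Real.log (x / t) := by
    rcases hx.eq_or_lt with rfl | h
    · simp [gain_of_le, ht.ne']
    · exact gain_of_lt h
  rw [key, gain_of_lt (hx.trans_lt hxy)]
  have h1 := Real.log_lt_sub_one_of_pos (div_pos hy0 hx0) (by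
    rw [Ne, div_eq_one_iff_eq hx0.ne']; exact hxy.ne')
  have h2 : Real.log (y / t) = Real.log (y / x) + Real.log (x / t) := by
    rw [← Real.log_mul (by positivity) (by positivity)]
    congr 1
    field_simp
  have h3 : t * (y / x - 1) ≤ y - x := by
    rw [show y / x - 1 = (y - x) / x by field_simp, mul_div_assoc', div_le_iff₀ hx0]
    nlinarith
  rw [h2]
  nlinarith

lemma gain_pos {t x : ℝ} (ht : 0 < t) (h : t < x) : 0 < gain t x := by
  have := gain_strictMonoOn ht le_rfl h
  rwa [gain_of_le le_rfl] at this

lemma gain_mono {t : ℝ} (ht : 0 < t) : Monotone (gain t) := by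
  intro x y hxy
  rcases le_or_gt x t with h | h
  · rw [gain_of_le h]; exact gain_nonneg ht y
  · rcases hxy.eq_or_lt with rfl | h'
    · exact le_rfl
    · exact (gain_strictMonoOn ht h.le h').le

/-- The tangent line of `gain t` at a point above the threshold lies strictly below the graph
everywhere else. -/
lemma gain_tangent_lt {t κ x : ℝ} (ht : 0 < t) (hκ : t < κ) (hne : x ≠ κ) :
    gain t κ + (1 - t / κ) * (x - κ) < gain t x := by
  have hκ0 : 0 < κ := ht.trans hκ
  -- the tangent line, relative to the formula for the gain that is valid above the threshold
  have line : ∀ z, 0 < z → gain t κ + (1 - t / κ) * (z - κ)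
      = z - t - t * Real.log (z / t) - t * (z / κ - 1 - Real.log (z / κ)) := by
    intro z hz
    rw [gain_of_lt hκ, Real.log_div hκ0.ne' ht.ne', Real.log_div hz.ne' ht.ne',
      Real.log_div hz.ne' hκ0.ne']
    field_simp
    ring
  rcases le_or_gt x t with h | h
  · have h1 : (1 - t / κ) * (x - κ) ≤ (1 - t / κ) * (t - κ) := by
      apply mul_le_mul_of_nonneg_left (by linarith)
      rw [sub_nonneg, div_le_one hκ0]; exact hκ.le
    have h2 := line t ht
    have h3 := Real.log_lt_sub_one_of_pos (div_pos ht hκ0) (by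
      rw [Ne, div_eq_one_iff_eq hκ0.ne']; exact hκ.ne)
    rw [div_self ht.ne', Real.log_one] at h2
    rw [gain_of_le h]
    nlinarith
  · have hx0 := ht.trans h
    rw [line x hx0, gain_of_lt h]
    have h3 := Real.log_lt_sub_one_of_pos (div_pos hx0 hκ0) (by
      rwa [Ne, div_eq_one_iff_eq hκ0.ne'])
    nlinarith

lemma scalarCost_softThreshold {t κ : ℝ} (ht : 0 < t) :
    scalarCost t (max (κ - t) 0) κ = -gain t κ := by
  rcases le_or_gt κ t with h | h
  · rw [max_eq_right (by linarith), scalarCost_zero, gain_of_le h, neg_zero]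
  · have hκ0 := ht.trans h
    rw [max_eq_left (by linarith), gain_of_lt h, scalarCost,
      show 1 + (κ - t) / t = κ / t by field_simp; ring]
    field_simp
    ring

/-- The scalar cost is minimized exactly by the soft-thresholded variance. -/
lemma neg_gain_lt_scalarCost {t a κ : ℝ} (ht : 0 < t) (ha : 0 ≤ a)
    (hne : a ≠ max (κ - t) 0) : -gain t κ < scalarCost t a κ := by
  have hat : 0 < a + t := by linarith
  rcases le_or_gt κ t with h | h
  · rw [max_eq_right (by linarith)] at hne
    have ha' : 0 < a := lt_of_le_of_ne ha hne.symm
    rw [gain_of_le h, scalarCost]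
    have h1 := Real.log_lt_sub_one_of_pos (x := (1 + a / t)⁻¹) (by positivity) (by
      rw [Ne, inv_eq_one]
      have : 0 < a / t := by positivity
      linarith)
    rw [Real.log_inv] at h1
    have h2 : (1 + a / t)⁻¹ - 1 = - (a / (a + t)) := by field_simp; ring
    rw [h2] at h1
    have h3 : κ * a / (a + t) ≤ t * (a / (a + t)) := by
      rw [mul_div_assoc]
      exact mul_le_mul_of_nonneg_right h (by positivity)
    nlinarith
  · have hκ0 := ht.trans h
    rw [max_eq_left (by linarith)] at hne
    rw [gain_of_lt h, scalarCost]
    have h1 := Real.log_lt_sub_one_of_pos (x := κ / (a + t)) (by positivity) (by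
      rw [Ne, div_eq_one_iff_eq hat.ne']
      intro h'
      exact hne (by linarith))
    have e1 : Real.log (1 + a / t) = Real.log (a + t) - Real.log t := by
      rw [← Real.log_div hat.ne' ht.ne']
      congr 1
      field_simp
      ring
    rw [e1, Real.log_div hκ0.ne' ht.ne']
    rw [Real.log_div hκ0.ne' hat.ne'] at h1
    have e2 : κ * a / (a + t) = κ - t * (κ / (a + t)) := by field_simp; ring
    rw [e2]
    nlinarith

lemma neg_gain_le_scalarCost {t a : ℝ} (κ : ℝ) (ht : 0 < t) (ha : 0 ≤ a) :
    -gain t κ ≤ scalarCost t a κ := by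
  by_cases h : a = max (κ - t) 0
  · rw [h, scalarCost_softThreshold ht]
  · exact (neg_gain_lt_scalarCost ht ha h).le

/-! ### One-dimensional Gaussian integrals -/

/-- The part `y² a / (2t(a+t)) - log (1 + a/t) / 2` of the dual potential that depends on the data
coordinate `y`, when the generated law has variance `a`. It is the logarithm of the ratio of the
centered Gaussian densities of variances `a + t` and `t` at `y`. -/
noncomputable def potential (t a y : ℝ) : ℝ :=
  y ^ 2 * a / (2 * t * (a + t)) - Real.log (1 + a / t) / 2

lemma potential_zero (t y : ℝ) : potential t 0 y = 0 := by simp [potential]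

lemma exp_half_log {x : ℝ} (hx : 0 < x) : Real.exp (Real.log x / 2) = √x := by
  rw [Real.sqrt_eq_rpow, Real.rpow_def_of_pos hx]
  congr 1
  ring

/-- Multiplying a Gaussian density by a factor that turns it into another Gaussian density gives
total mass one. -/
lemma lintegral_gaussianReal_eq_one_of_density {v : ℝ} (hv : 0 < v) {g : ℝ → ℝ}
    (hg : Measurable g) {m w : ℝ} (hw : 0 < w)
    (h : ∀ x, (√(2 * Real.pi * v))⁻¹ * Real.exp (-x ^ 2 / (2 * v)) * g x
      = (√(2 * Real.pi * w))⁻¹ * Real.exp (-(x - m) ^ 2 / (2 * w))) :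
    ∫⁻ x, ENNReal.ofReal (g x) ∂gaussianReal 0 v.toNNReal = 1 := by
  have hv' : v.toNNReal ≠ 0 := by simpa using hv
  have hw' : w.toNNReal ≠ 0 := by simpa using hw
  rw [gaussianReal_of_var_ne_zero _ hv',
    lintegral_withDensity_eq_lintegral_mul _ (measurable_gaussianPDF _ _) (by fun_prop),
    ← lintegral_gaussianPDF_eq_one m hw']
  refine lintegral_congr fun x => ?_
  simp only [Pi.mul_apply, gaussianPDF]
  rw [← ENNReal.ofReal_mul (gaussianPDFReal_nonneg _ _ _)]
  congr 1
  simp only [gaussianPDFReal, Real.coe_toNNReal _ hv.le, Real.coe_toNNReal _ hw.le, sub_zero]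
  exact h x

/-- The potential normalizes the tilt in the generated coordinate. For `a = 0` the law is the Dirac
mass at the origin. -/
lemma lintegral_exp_potential_generated {t a : ℝ} (ht : 0 < t) (ha : 0 ≤ a) (y : ℝ) :
    ∫⁻ x, ENNReal.ofReal (Real.exp (x * y / t - x ^ 2 / (2 * t) - potential t a y))
      ∂gaussianReal 0 a.toNNReal = 1 := by
  rcases ha.eq_or_lt with rfl | ha
  · simp [potential_zero]
  have hat : 0 < a + t := by linarith
  refine lintegral_gaussianReal_eq_one_of_density ha (by fun_prop)
    (m := a * y / (a + t)) (w := a * t / (a + t)) (by positivity) fun x => ?_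
  have e1 : √(2 * Real.pi * a) = √(2 * Real.pi * (a * t / (a + t))) * √(1 + a / t) := by
    rw [← Real.sqrt_mul (by positivity)]
    congr 1
    field_simp
    ring
  have e2 : x * y / t - x ^ 2 / (2 * t) - potential t a y = Real.log (1 + a / t) / 2
      + (x * y / t - x ^ 2 / (2 * t) - y ^ 2 * a / (2 * t * (a + t))) := by
    rw [potential]; ring
  rw [e2, Real.exp_add, exp_half_log (by positivity), e1, mul_inv]
  have e3 : Real.exp (-(x - a * y / (a + t)) ^ 2 / (2 * (a * t / (a + t))))
      = Real.exp (-x ^ 2 / (2 * a)) * Real.exp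
        (x * y / t - x ^ 2 / (2 * t) - y ^ 2 * a / (2 * t * (a + t))) := by
    rw [← Real.exp_add]
    congr 1
    field_simp
    ring
  rw [e3]
  field_simp

/-- The tilt is normalized in the data coordinate as well if the data variance is `a + t`: the tilted
law of `y` is `N(z, t)`. A direction without generated variance carries no tilt. -/
lemma lintegral_exp_potential_data {t a k z : ℝ} (ht : 0 < t) (ha : 0 ≤ a)
    (h : k = a + t ∨ (a = 0 ∧ z = 0)) :
    ∫⁻ y, ENNReal.ofReal (Real.exp (z * y / t - z ^ 2 / (2 * t) - potential t a y))
      ∂gaussianReal 0 k.toNNReal = 1 := by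
  rcases h with rfl | ⟨rfl, rfl⟩
  swap
  · simp [potential_zero]
  have hat : 0 < a + t := by linarith
  refine lintegral_gaussianReal_eq_one_of_density hat
    (by unfold potential; fun_prop) (m := z) (w := t) ht fun y => ?_
  have e1 : √(2 * Real.pi * (a + t)) = √(2 * Real.pi * t) * √(1 + a / t) := by
    rw [← Real.sqrt_mul (by positivity)]
    congr 1
    field_simp
    ring
  have e2 : z * y / t - z ^ 2 / (2 * t) - potential t a y = Real.log (1 + a / t) / 2
      + (z * y / t - z ^ 2 / (2 * t) - y ^ 2 * a / (2 * t * (a + t))) := by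
    rw [potential]; ring
  rw [e2, Real.exp_add, exp_half_log (by positivity), e1, mul_inv]
  have e3 : Real.exp (-(y - z) ^ 2 / (2 * t))
      = Real.exp (-y ^ 2 / (2 * (a + t))) * Real.exp
        (z * y / t - z ^ 2 / (2 * t) - y ^ 2 * a / (2 * t * (a + t))) := by
    rw [← Real.exp_add]
    congr 1
    field_simp
    ring
  rw [e3]
  field_simp

/-! ### The Gibbs variational principle -/

section Gibbs

variable {α : Type*} [MeasurableSpace α] {μ π : Measure α} {φ : α → ℝ}

lemma integrable_exp_of_lintegral_eq_one (hφ : Measurable φ)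
    (h1 : ∫⁻ x, ENNReal.ofReal (Real.exp (φ x)) ∂μ = 1) :
    Integrable (fun x => Real.exp (φ x)) μ := by
  refine ⟨by fun_prop, ?_⟩
  rw [hasFiniteIntegral_iff_ofReal (ae_of_all _ fun x => (Real.exp_pos _).le), h1]
  exact ENNReal.one_lt_top

lemma integral_exp_of_lintegral_eq_one (hφ : Measurable φ)
    (h1 : ∫⁻ x, ENNReal.ofReal (Real.exp (φ x)) ∂μ = 1) :
    ∫ x, Real.exp (φ x) ∂μ = 1 := by
  rw [integral_eq_lintegral_of_nonneg_ae (ae_of_all _ fun x => (Real.exp_pos _).le) (by fun_prop),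
    h1, ENNReal.toReal_one]

/-- The integral of a potential whose exponential has mean one is a lower bound for the
Kullback-Leibler divergence. -/
lemma ofReal_integral_le_klDiv [IsProbabilityMeasure μ] [IsProbabilityMeasure π]
    (hφ : Measurable φ) (h1 : ∫⁻ x, ENNReal.ofReal (Real.exp (φ x)) ∂μ = 1)
    (hint : Integrable φ π) :
    ENNReal.ofReal (∫ x, φ x ∂π) ≤ klDiv π μ := by
  by_cases htop : klDiv π μ = ∞
  · simp [htop]
  obtain ⟨hac, hllr⟩ := klDiv_ne_top_iff.1 htop
  have hexp := integrable_exp_of_lintegral_eq_one hφ h1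
  have := isProbabilityMeasure_tilted hexp
  -- the bound is the nonnegativity of the divergence of `π` from `μ` tilted by `φ`
  have hnn := integral_llr_add_sub_measure_univ_nonneg
    (hac.trans (absolutelyContinuous_tilted hexp))
    (integrable_llr_tilted_right hac hint hllr hexp)
  rw [integral_llr_tilted_right hac hint hexp hllr, integral_exp_of_lintegral_eq_one hφ h1] at hnn
  refine ENNReal.ofReal_le_of_le_toReal ?_
  rw [toReal_klDiv_of_measure_eq hac (by simp)]
  simp only [Real.log_one, add_zero, probReal_univ, add_sub_cancel_right] at hnn
  linarith

/-- The tilted measure attains the bound `ofReal_integral_le_klDiv`. -/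
lemma klDiv_tilted_eq [IsProbabilityMeasure μ]
    (hφ : Measurable φ) (h1 : ∫⁻ x, ENNReal.ofReal (Real.exp (φ x)) ∂μ = 1)
    (hint : Integrable φ (μ.tilted φ)) :
    0 ≤ ∫ x, φ x ∂(μ.tilted φ) ∧
      klDiv (μ.tilted φ) μ = ENNReal.ofReal (∫ x, φ x ∂(μ.tilted φ)) := by
  have hexp := integrable_exp_of_lintegral_eq_one hφ h1
  have := isProbabilityMeasure_tilted hexp
  have hac := tilted_absolutelyContinuous μ φ
  have hllr : llr (μ.tilted φ) μ =ᵐ[μ.tilted φ] φ := by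
    filter_upwards [hac.ae_le (log_rnDeriv_tilted_left_self hexp)] with x hx
    rw [integral_exp_of_lintegral_eq_one hφ h1, Real.log_one, sub_zero] at hx
    exact hx
  have hllr' := (integrable_congr hllr).2 hint
  have hnn := integral_llr_add_sub_measure_univ_nonneg hac hllr'
  rw [klDiv_of_ac_of_integrable hac hllr', integral_congr_ae hllr]
  rw [integral_congr_ae hllr] at hnn
  simpa using hnn

lemma tilted_eq_withDensity (hφ : Measurable φ)
    (h1 : ∫⁻ x, ENNReal.ofReal (Real.exp (φ x)) ∂μ = 1) :
    μ.tilted φ = μ.withDensity (fun x => ENNReal.ofReal (Real.exp (φ x))) := by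
  rw [Measure.tilted, integral_exp_of_lintegral_eq_one hφ h1]
  simp

end Gibbs

/-- If every conditional mass of a density with respect to a product measure is one, the measure
with that density has the given marginals. -/
lemma withDensity_mem_couplings {E F : Type*} [MeasurableSpace E] [MeasurableSpace F]
    {P : Measure E} {Q : Measure F} [SFinite P] [SFinite Q] {g : E × F → ℝ≥0∞} (hg : Measurable g)
    (h1 : ∀ᵐ z ∂P, ∫⁻ y, g (z, y) ∂Q = 1) (h2 : ∀ᵐ y ∂Q, ∫⁻ z, g (z, y) ∂P = 1) :
    (P.prod Q).withDensity g ∈ couplings P Q := by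
  constructor
  · ext s hs
    rw [Measure.map_apply measurable_fst hs, withDensity_apply _ (measurable_fst hs),
      ← Set.prod_univ, ← Measure.prod_restrict, Measure.restrict_univ,
      lintegral_prod _ hg.aemeasurable, lintegral_congr_ae (ae_restrict_of_ae h1)]
    simp
  · ext s hs
    rw [Measure.map_apply measurable_snd hs, withDensity_apply _ (measurable_snd hs),
      ← Set.univ_prod, ← Measure.prod_restrict, Measure.restrict_univ,
      lintegral_prod_symm _ hg.aemeasurable, lintegral_congr_ae (ae_restrict_of_ae h2)]
    simp

/-! ### Gaussian laws with diagonal covariance -/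

section Diagonal

variable {d : ℕ}

/-- Under `P`, the coordinates in the orthonormal basis `f` are independent centered Gaussian
variables with variances `a`. -/
structure IsDiagonalGaussian {d : ℕ} (P : Measure (EuclideanSpace ℝ (Fin d)))
    (f : OrthonormalBasis (Fin d) ℝ (EuclideanSpace ℝ (Fin d))) (a : Fin d → ℝ) : Prop where
  indep : iIndepFun (fun i x => inner ℝ (f i) x) P
  law : ∀ i, P.map (fun x => inner ℝ (f i) x) = gaussianReal 0 (a i).toNNReal

lemma isDiagonalGaussian_of_covarianceBilin {P : Measure (EuclideanSpace ℝ (Fin d))} [IsGaussian P]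
    (hP : ∫ x, x ∂P = 0) {f : OrthonormalBasis (Fin d) ℝ (EuclideanSpace ℝ (Fin d))} {a : Fin d → ℝ}
    (h : ∀ i j, covarianceBilin P (f i) (f j) = if i = j then a i else 0) :
    IsDiagonalGaussian P f a := by
  have hmem : MemLp id 2 P := IsGaussian.memLp_two_id
  refine ⟨?_, fun i => ?_⟩
  · refine HasGaussianLaw.iIndepFun_of_covariance_eq_zero (P := P) ?_ fun i j hij => ?_
    · exact (IsGaussian.hasGaussianLaw_id (μ := P)).map_fun
        (ContinuousLinearMap.pi fun i => innerSL ℝ (f i))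
    · rw [← covarianceBilin_apply_eq_cov hmem, h, if_neg hij]
  · have := IsGaussian.map_eq_gaussianReal (μ := P) (innerSL ℝ (f i))
    rw [(innerSL ℝ (f i)).integral_comp_id_comm IsGaussian.integrable_id] at this
    simp only [hP, map_zero] at this
    have hv : Var[⇑(innerSL ℝ (f i)); P] = a i := by
      have := covarianceBilin_self hmem (f i)
      rw [h, if_pos rfl] at this
      exact this.symm
    rw [hv] at this
    exact this

lemma IsDiagonalGaussian.lintegral_prod {P : Measure (EuclideanSpace ℝ (Fin d))}
    {f : OrthonormalBasis (Fin d) ℝ (EuclideanSpace ℝ (Fin d))}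
    {a : Fin d → ℝ} (h : IsDiagonalGaussian P f a) {g : Fin d → ℝ → ℝ≥0∞}
    (hg : ∀ i, Measurable (g i)) :
    ∫⁻ x, ∏ i, g i (inner ℝ (f i) x) ∂P = ∏ i, ∫⁻ s, g i s ∂gaussianReal 0 (a i).toNNReal := by
  rw [lintegral_prod_eq_prod_lintegral_of_indepFun Finset.univ
    (fun i x => g i (inner ℝ (f i) x)) (h.indep.comp g hg) (fun i => by
      have := hg i
      fun_prop)]
  refine Finset.prod_congr rfl fun i _ => ?_
  rw [← h.law i, lintegral_map (hg i) (by fun_prop)]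

end Diagonal

/-! ### The dual potential and the value of the entropic transport problem -/

section Dual

variable {d : ℕ}

/-- The dual potential `φ(z, y)`, written in the coordinates of the orthonormal basis `f`. The
exponential of `φ` is the density of the law of `(Z, Z + N)` with respect to the product of its
marginals when `Z` has independent Gaussian coordinates of variances `a` and `N ~ N(0, t I)` is an
independent noise. -/
noncomputable def dualPotential (t : ℝ)
    (f : OrthonormalBasis (Fin d) ℝ (EuclideanSpace ℝ (Fin d))) (a : Fin d → ℝ)
    (z : EuclideanSpace ℝ (Fin d) × EuclideanSpace ℝ (Fin d)) : ℝ :=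
  ∑ i, (inner ℝ (f i) z.1 * inner ℝ (f i) z.2 / t - inner ℝ (f i) z.1 ^ 2 / (2 * t)
    - potential t (a i) (inner ℝ (f i) z.2))

/-- The second moment of the law `Q` in the direction `v`. -/
noncomputable def directionalMoment (Q : Measure (EuclideanSpace ℝ (Fin d)))
    (v : EuclideanSpace ℝ (Fin d)) : ℝ := ∫ y, inner ℝ v y ^ 2 ∂Q

/-- The value of the dual problem at `dualPotential`. -/
noncomputable def dualValue (t : ℝ)
    (f : OrthonormalBasis (Fin d) ℝ (EuclideanSpace ℝ (Fin d))) (a : Fin d → ℝ)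
    (Q : Measure (EuclideanSpace ℝ (Fin d))) : ℝ :=
  ∑ i, (directionalMoment Q (f i) + scalarCost t (a i) (directionalMoment Q (f i)))

variable {t : ℝ} {f : OrthonormalBasis (Fin d) ℝ (EuclideanSpace ℝ (Fin d))} {a k : Fin d → ℝ}
  {P Q : Measure (EuclideanSpace ℝ (Fin d))}

lemma measurable_potential (t a : ℝ) : Measurable (potential t a) := by
  unfold potential
  fun_prop

lemma measurable_dualPotential : Measurable (dualPotential t f a) := by
  unfold dualPotential potential
  fun_prop

/-- The transport cost and the dual potential add up to a function of the data point alone. -/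
lemma norm_sub_sq_add_dualPotential (ht : 0 < t)
    (z : EuclideanSpace ℝ (Fin d) × EuclideanSpace ℝ (Fin d)) :
    ‖z.1 - z.2‖ ^ 2 + 2 * t * dualPotential t f a z
      = ∑ i, (inner ℝ (f i) z.2 ^ 2 - 2 * t * potential t (a i) (inner ℝ (f i) z.2)) := by
  rw [← f.sum_sq_inner_right, dualPotential, Finset.mul_sum, ← Finset.sum_add_distrib]
  refine Finset.sum_congr rfl fun i _ => ?_
  rw [inner_sub_right]
  field_simp
  ring

lemma ofReal_exp_dualPotential (z y : EuclideanSpace ℝ (Fin d)) :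
    ENNReal.ofReal (Real.exp (dualPotential t f a (z, y))) = ∏ i, ENNReal.ofReal (Real.exp
      (inner ℝ (f i) z * inner ℝ (f i) y / t - inner ℝ (f i) z ^ 2 / (2 * t)
        - potential t (a i) (inner ℝ (f i) y))) := by
  rw [dualPotential, Real.exp_sum, ENNReal.ofReal_prod_of_nonneg fun i _ => (Real.exp_pos _).le]

lemma IsDiagonalGaussian.lintegral_exp_dualPotential (ht : 0 < t) (ha : ∀ i, 0 ≤ a i)
    (h : IsDiagonalGaussian P f a) (y : EuclideanSpace ℝ (Fin d)) :
    ∫⁻ z, ENNReal.ofReal (Real.exp (dualPotential t f a (z, y))) ∂P = 1 := by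
  simp_rw [ofReal_exp_dualPotential]
  rw [h.lintegral_prod (g := fun i x => ENNReal.ofReal (Real.exp
    (x * inner ℝ (f i) y / t - x ^ 2 / (2 * t) - potential t (a i) (inner ℝ (f i) y))))
    (fun i => by fun_prop)]
  exact Finset.prod_eq_one fun i _ => lintegral_exp_potential_generated ht (ha i) _

/-- When the data law has variance `a i + t` in each direction that the generated law charges, the
exponential of the dual potential is also normalized in the data variable. -/
lemma IsDiagonalGaussian.ae_lintegral_exp_dualPotential (ht : 0 < t) (ha : ∀ i, 0 ≤ a i)
    (hP : IsDiagonalGaussian P f a) (hQ : IsDiagonalGaussian Q f k)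
    (hk : ∀ i, a i ≠ 0 → k i = a i + t) :
    ∀ᵐ z ∂P, ∫⁻ y, ENNReal.ofReal (Real.exp (dualPotential t f a (z, y))) ∂Q = 1 := by
  have hz : ∀ᵐ z ∂P, ∀ i, a i = 0 → inner ℝ (f i) z = 0 := by
    refine ae_all_iff.2 fun i => ?_
    by_cases hi : a i = 0
    · have := hP.law i
      rw [hi, Real.toNNReal_zero, gaussianReal_zero_var] at this
      have h0 : ∀ᵐ s ∂(P.map fun x => inner ℝ (f i) x), s = 0 := by
        rw [this]
        exact (ae_dirac_iff (measurableSet_singleton (0 : ℝ))).2 rfl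
      filter_upwards [ae_of_ae_map (by fun_prop) h0] with z hz _ using hz
    · exact ae_of_all _ fun z h => absurd h hi
  filter_upwards [hz] with z hz
  simp_rw [ofReal_exp_dualPotential]
  rw [hQ.lintegral_prod (g := fun i x => ENNReal.ofReal (Real.exp
    (inner ℝ (f i) z * x / t - inner ℝ (f i) z ^ 2 / (2 * t) - potential t (a i) x)))
    (fun i => by
      have := measurable_potential t (a i)
      fun_prop)]
  refine Finset.prod_eq_one fun i _ => lintegral_exp_potential_data ht (ha i) ?_
  by_cases hi : a i = 0
  · exact Or.inr ⟨hi, hz i hi⟩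
  · exact Or.inl (hk i hi)

section Coupling

variable {π : Measure (EuclideanSpace ℝ (Fin d) × EuclideanSpace ℝ (Fin d))}

lemma memLp_inner_fst_of_mem_couplings (hπ : π ∈ couplings P Q) (hP : MemLp id 2 P)
    (v : EuclideanSpace ℝ (Fin d)) : MemLp (fun z => inner ℝ v z.1) 2 π := by
  have h : MemLp (fun x => inner ℝ v x) 2 (π.map Prod.fst) := by
    rw [hπ.1]; exact hP.const_inner v
  exact h.comp_of_map (by fun_prop)

lemma memLp_inner_snd_of_mem_couplings (hπ : π ∈ couplings P Q) (hQ : MemLp id 2 Q)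
    (v : EuclideanSpace ℝ (Fin d)) : MemLp (fun z => inner ℝ v z.2) 2 π := by
  have h : MemLp (fun x => inner ℝ v x) 2 (π.map Prod.snd) := by
    rw [hπ.2]; exact hQ.const_inner v
  exact h.comp_of_map (by fun_prop)

lemma isProbabilityMeasure_of_mem_couplings [IsProbabilityMeasure P] (hπ : π ∈ couplings P Q) :
    IsProbabilityMeasure π := by
  have : IsProbabilityMeasure (π.map Prod.fst) := by rw [hπ.1]; infer_instance
  exact Measure.isProbabilityMeasure_of_map Prod.fst

lemma integrable_dualPotential [IsProbabilityMeasure P] (hπ : π ∈ couplings P Q)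
    (hP : MemLp id 2 P) (hQ : MemLp id 2 Q) : Integrable (dualPotential t f a) π := by
  have := isProbabilityMeasure_of_mem_couplings hπ
  unfold dualPotential potential
  refine integrable_finsetSum _ fun i _ => ?_
  have h1 := memLp_inner_fst_of_mem_couplings hπ hP (f i)
  have h2 := memLp_inner_snd_of_mem_couplings hπ hQ (f i)
  refine Integrable.sub (Integrable.sub ?_ ?_) (Integrable.sub ?_ (integrable_const _))
  · exact (h1.integrable_mul h2).div_const _
  · exact h1.integrable_sq.div_const _
  · exact (h2.integrable_sq.mul_const _).div_const _

lemma integrable_norm_sub_sq (hπ : π ∈ couplings P Q)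
    (hP : MemLp id 2 P) (hQ : MemLp id 2 Q) : Integrable (fun z => ‖z.1 - z.2‖ ^ 2) π := by
  have h1 : MemLp (fun z : EuclideanSpace ℝ (Fin d) × EuclideanSpace ℝ (Fin d) => z.1) 2 π := by
    have h : MemLp id 2 (π.map Prod.fst) := by rw [hπ.1]; exact hP
    exact h.comp_of_map (by fun_prop)
  have h2 : MemLp (fun z : EuclideanSpace ℝ (Fin d) × EuclideanSpace ℝ (Fin d) => z.2) 2 π := by
    have h : MemLp id 2 (π.map Prod.snd) := by rw [hπ.2]; exact hQ
    exact h.comp_of_map (by fun_prop)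
  exact (h1.sub h2).integrable_norm_pow (by norm_num)

lemma integral_cost_add_dualPotential [IsProbabilityMeasure P] [IsProbabilityMeasure Q]
    (ht : 0 < t) (ha : ∀ i, 0 ≤ a i) (hπ : π ∈ couplings P Q)
    (hP : MemLp id 2 P) (hQ : MemLp id 2 Q) :
    ∫ z, ‖z.1 - z.2‖ ^ 2 ∂π + 2 * t * ∫ z, dualPotential t f a z ∂π = dualValue t f a Q := by
  rw [← integral_const_mul, ← integral_add (integrable_norm_sub_sq hπ hP hQ)
    ((integrable_dualPotential hπ hP hQ).const_mul _)]
  simp_rw [norm_sub_sq_add_dualPotential ht]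
  have hsq : ∀ i, Integrable (fun y => inner ℝ (f i) y ^ 2) Q := fun i =>
    (hQ.const_inner (f i)).integrable_sq
  calc ∫ z, ∑ i, (inner ℝ (f i) z.2 ^ 2 - 2 * t * potential t (a i) (inner ℝ (f i) z.2)) ∂π
      = ∫ y, ∑ i, (inner ℝ (f i) y ^ 2 - 2 * t * potential t (a i) (inner ℝ (f i) y)) ∂Q := by
        rw [← hπ.2, integral_map (by fun_prop)]
        unfold potential
        exact Measurable.aestronglyMeasurable (by fun_prop)
    _ = ∫ y, ∑ i, (inner ℝ (f i) y ^ 2 * (1 - a i / (a i + t))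
          + t * Real.log (1 + a i / t)) ∂Q := by
        refine integral_congr_ae (ae_of_all _ fun y => Finset.sum_congr rfl fun i _ => ?_)
        have : a i + t ≠ 0 := by linarith [ha i]
        rw [potential]
        field_simp
        ring
    _ = dualValue t f a Q := by
        have hI : ∀ i, Integrable (fun y => inner ℝ (f i) y ^ 2 * (1 - a i / (a i + t))
            + t * Real.log (1 + a i / t)) Q :=
          fun i => ((hsq i).mul_const _).add (integrable_const _)
        rw [integral_finsetSum _ fun i _ => hI i]
        refine Finset.sum_congr rfl fun i _ => ?_
        rw [integral_add ((hsq i).mul_const _) (integrable_const _), integral_mul_const]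
        simp only [integral_const, probReal_univ, smul_eq_mul, one_mul, directionalMoment,
          scalarCost]
        ring

lemma mutualInformation_of_mem_couplings (hπ : π ∈ couplings P Q) :
    mutualInformation π = klDiv π (P.prod Q) := by
  rw [mutualInformation, hπ.1, hπ.2]

end Coupling

lemma IsDiagonalGaussian.lintegral_prod_exp_dualPotential [IsProbabilityMeasure P]
    [IsProbabilityMeasure Q] (ht : 0 < t) (ha : ∀ i, 0 ≤ a i) (h : IsDiagonalGaussian P f a) :
    ∫⁻ z, ENNReal.ofReal (Real.exp (dualPotential t f a z)) ∂(P.prod Q) = 1 := by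
  rw [MeasureTheory.lintegral_prod_symm _ (by
    have := measurable_dualPotential (t := t) (f := f) (a := a)
    fun_prop)]
  simp [h.lintegral_exp_dualPotential ht ha]

/-- Weak duality: the dual value bounds the entropic transport cost from below. -/
lemma IsDiagonalGaussian.dualValue_le_entropicW2Sq [IsProbabilityMeasure P]
    [IsProbabilityMeasure Q] (ht : 0 < t) (ha : ∀ i, 0 ≤ a i) (h : IsDiagonalGaussian P f a)
    (hP : MemLp id 2 P) (hQ : MemLp id 2 Q) :
    ENNReal.ofReal (dualValue t f a Q) ≤ entropicW2Sq (2 * t) P Q := by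
  refine le_iInf₂ fun π hπ => ?_
  have := isProbabilityMeasure_of_mem_couplings hπ
  rw [mutualInformation_of_mem_couplings hπ, ← integral_cost_add_dualPotential ht ha hπ hP hQ,
    ← ofReal_integral_eq_lintegral_ofReal (integrable_norm_sub_sq hπ hP hQ)
      (ae_of_all _ fun z => by positivity)]
  refine ENNReal.ofReal_add_le.trans (add_le_add le_rfl ?_)
  rw [ENNReal.ofReal_mul (by positivity)]
  gcongr
  exact ofReal_integral_le_klDiv measurable_dualPotential
    (h.lintegral_prod_exp_dualPotential ht ha) (integrable_dualPotential hπ hP hQ)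

/-- Strong duality when data and generated law are diagonal in the same basis and the data law has
variance `a i + t` in each direction charged by the generated law. The optimal coupling is the
product of the marginals tilted by the dual potential. -/
lemma IsDiagonalGaussian.entropicW2Sq_le_dualValue [IsProbabilityMeasure P]
    [IsProbabilityMeasure Q] (ht : 0 < t) (ha : ∀ i, 0 ≤ a i) (h : IsDiagonalGaussian P f a)
    (hQd : IsDiagonalGaussian Q f k) (hk : ∀ i, a i ≠ 0 → k i = a i + t)
    (hP : MemLp id 2 P) (hQ : MemLp id 2 Q) :
    entropicW2Sq (2 * t) P Q ≤ ENNReal.ofReal (dualValue t f a Q) := by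
  have hm := measurable_dualPotential (t := t) (f := f) (a := a)
  have h1 := h.lintegral_prod_exp_dualPotential (Q := Q) ht ha
  have hπ : (P.prod Q).tilted (dualPotential t f a) ∈ couplings P Q := by
    rw [tilted_eq_withDensity hm h1]
    exact withDensity_mem_couplings (by fun_prop)
      (h.ae_lintegral_exp_dualPotential ht ha hQd hk)
      (ae_of_all _ (h.lintegral_exp_dualPotential ht ha))
  have hint := integrable_dualPotential (t := t) (f := f) (a := a) hπ hP hQ
  obtain ⟨hnn, hkl⟩ := klDiv_tilted_eq hm h1 hint
  refine (iInf₂_le _ hπ).trans (le_of_eq ?_)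
  rw [mutualInformation_of_mem_couplings hπ, hkl,
    ← integral_cost_add_dualPotential ht ha hπ hP hQ,
    ← ofReal_integral_eq_lintegral_ofReal (integrable_norm_sub_sq hπ hP hQ)
      (ae_of_all _ fun z => by positivity),
    ← ENNReal.ofReal_mul (by positivity), ENNReal.ofReal_add (by positivity) (by positivity)]

end Dual

/-! ### Covariance matrices and Gaussian laws -/

section Covariance

variable {d r : ℕ}

lemma covarianceBilin_eq_covarianceMatrix {P : Measure (EuclideanSpace ℝ (Fin d))}
    [IsFiniteMeasure P] (hP : MemLp id 2 P) (x y : EuclideanSpace ℝ (Fin d)) :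
    covarianceBilin P x y = inner ℝ x (WithLp.toLp 2 ((covarianceMatrix P).mulVec y.ofLp)) := by
  have h := covarianceBilin_apply_pi (μ := P) (X := fun i (x : EuclideanSpace ℝ (Fin d)) => x i)
    (fun i => by simpa only [EuclideanSpace.basisFun_inner, id] using
      hP.const_inner (𝕜 := ℝ) (EuclideanSpace.basisFun (Fin d) ℝ i)) x y
  simp only [WithLp.toLp_ofLp] at h
  rw [Measure.map_id'] at h
  rw [h, PiLp.inner_apply]
  refine Finset.sum_congr rfl fun i _ => ?_
  simp only [Matrix.mulVec, dotProduct, covarianceMatrix, Matrix.of_apply, RCLike.inner_apply,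
    conj_trivial, Finset.sum_mul]
  refine Finset.sum_congr rfl fun j _ => ?_
  ring

lemma covarianceMatrix_multivariateGaussian {K : Matrix (Fin d) (Fin d) ℝ} (hK : K.PosSemidef) :
    covarianceMatrix (multivariateGaussian 0 K) = K := by
  ext i j
  exact covariance_eval_multivariateGaussian hK i j

/-- The linear map `x ↦ G x` between Euclidean spaces. -/
noncomputable def generatorCLM (G : Matrix (Fin d) (Fin r) ℝ) :
    EuclideanSpace ℝ (Fin r) →L[ℝ] EuclideanSpace ℝ (Fin d) :=
  LinearMap.toContinuousLinearMap (Matrix.toEuclideanLin G)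

lemma generatedLaw_eq_map (G : Matrix (Fin d) (Fin r) ℝ) :
    generatedLaw G = (stdGaussian (EuclideanSpace ℝ (Fin r))).map (generatorCLM G) := rfl

instance isGaussian_generatedLaw (G : Matrix (Fin d) (Fin r) ℝ) : IsGaussian (generatedLaw G) := by
  rw [generatedLaw_eq_map]
  infer_instance

lemma integral_id_generatedLaw (G : Matrix (Fin d) (Fin r) ℝ) : ∫ x, x ∂(generatedLaw G) = 0 := by
  rw [generatedLaw_eq_map, ContinuousLinearMap.integral_id_map IsGaussian.integrable_id,
    integral_id_stdGaussian, map_zero]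

lemma covarianceMatrix_generatedLaw (G : Matrix (Fin d) (Fin r) ℝ) :
    covarianceMatrix (generatedLaw G) = G * G.transpose := by
  have key : ∀ i, (generatorCLM G).adjoint (EuclideanSpace.basisFun (Fin d) ℝ i)
      = WithLp.toLp 2 (G i) := by
    intro i
    refine ext_inner_right ℝ fun x => ?_
    rw [ContinuousLinearMap.adjoint_inner_left, EuclideanSpace.basisFun_inner, PiLp.inner_apply]
    change ∑ j, G i j * x j = _
    simp [mul_comm]
  ext i j
  have h := covarianceBilin_eq_covarianceMatrix (P := generatedLaw G) IsGaussian.memLp_two_id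
    (EuclideanSpace.basisFun (Fin d) ℝ i) (EuclideanSpace.basisFun (Fin d) ℝ j)
  rw [generatedLaw_eq_map, covarianceBilin_map IsGaussian.memLp_two_id, covarianceBilin_stdGaussian,
    key, key, innerSL_apply_apply, EuclideanSpace.basisFun_inner] at h
  simp only [EuclideanSpace.basisFun_apply, PiLp.ofLp_single, Matrix.mulVec_single_one,
    Matrix.col_apply] at h
  rw [generatedLaw_eq_map, ← h, PiLp.inner_apply, Matrix.mul_apply]
  simp [mul_comm]

lemma posSemidef_covarianceMatrix_generatedLaw (G : Matrix (Fin d) (Fin r) ℝ) :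
    (covarianceMatrix (generatedLaw G)).PosSemidef := by
  rw [covarianceMatrix_generatedLaw]
  simpa using Matrix.posSemidef_self_mul_conjTranspose G

lemma rank_covarianceMatrix_generatedLaw_le (G : Matrix (Fin d) (Fin r) ℝ) :
    (covarianceMatrix (generatedLaw G)).rank ≤ r := by
  rw [covarianceMatrix_generatedLaw]
  exact (Matrix.rank_mul_le_left _ _).trans (by simpa using G.rank_le_width)

variable {P : Measure (EuclideanSpace ℝ (Fin d))} [IsGaussian P]

/-- A centered Gaussian law has independent coordinates in every orthonormal eigenbasis of its
covariance matrix. -/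
lemma isDiagonalGaussian_of_eigenbasis (hP : ∫ x, x ∂P = 0)
    {f : OrthonormalBasis (Fin d) ℝ (EuclideanSpace ℝ (Fin d))} {a : Fin d → ℝ}
    (h : ∀ i, (covarianceMatrix P).mulVec (f i).ofLp = a i • (f i).ofLp) :
    IsDiagonalGaussian P f a := by
  refine isDiagonalGaussian_of_covarianceBilin hP fun i j => ?_
  rw [covarianceBilin_eq_covarianceMatrix IsGaussian.memLp_two_id, h, WithLp.toLp_smul,
    WithLp.toLp_ofLp, inner_smul_right, f.inner_eq_ite]
  split_ifs with hij
  · rw [hij, mul_one]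
  · rw [mul_zero]

lemma directionalMoment_eq_inner (hP : ∫ x, x ∂P = 0) (v : EuclideanSpace ℝ (Fin d)) :
    directionalMoment P v
      = inner ℝ v (WithLp.toLp 2 ((covarianceMatrix P).mulVec v.ofLp)) := by
  have hmem : MemLp id 2 P := IsGaussian.memLp_two_id
  rw [← covarianceBilin_eq_covarianceMatrix hmem, covarianceBilin_self hmem,
    variance_of_integral_eq_zero (by fun_prop)]
  · rfl
  · have := (innerSL ℝ v).integral_comp_id_comm (IsGaussian.integrable_id (μ := P))
    rw [hP, map_zero] at this
    exact this

/-- The second moment in the direction `v` is the average of the eigenvalues of the covariance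
matrix, weighted by the squared coordinates of `v` in an eigenbasis. -/
lemma directionalMoment_eq_sum (hP : ∫ x, x ∂P = 0)
    {u : OrthonormalBasis (Fin d) ℝ (EuclideanSpace ℝ (Fin d))} {k : Fin d → ℝ}
    (h : ∀ i, (covarianceMatrix P).mulVec (u i).ofLp = k i • (u i).ofLp)
    (v : EuclideanSpace ℝ (Fin d)) :
    directionalMoment P v = ∑ i, inner ℝ v (u i) ^ 2 * k i := by
  have hv : WithLp.toLp 2 ((covarianceMatrix P).mulVec v.ofLp)
      = ∑ i, (inner ℝ (u i) v * k i) • u i := by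
    change Matrix.toEuclideanLin (covarianceMatrix P) v = _
    conv_lhs => rw [← u.sum_repr' v]
    rw [map_sum]
    refine Finset.sum_congr rfl fun i _ => ?_
    rw [map_smul, mul_smul]
    congr 1
    change WithLp.toLp 2 ((covarianceMatrix P).mulVec (u i).ofLp) = _
    rw [h i, WithLp.toLp_smul, WithLp.toLp_ofLp]
  rw [directionalMoment_eq_inner hP, hv, inner_sum]
  refine Finset.sum_congr rfl fun i _ => ?_
  rw [inner_smul_right, real_inner_comm v (u i)]
  ring

end Covariance

/-! ### Sorted and simultaneous eigenbases -/

section Eigenbasis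

variable {d : ℕ} {A B : Matrix (Fin d) (Fin d) ℝ}

lemma toEuclideanLin_eq_smul_iff {v : EuclideanSpace ℝ (Fin d)} {c : ℝ} :
    Matrix.toEuclideanLin A v = c • v ↔ A.mulVec v.ofLp = c • v.ofLp :=
  ⟨fun h => congrArg WithLp.ofLp h, fun h => congrArg (WithLp.toLp 2) h⟩

lemma sortedEigenvalue_antitone (hA : A.IsHermitian) : Antitone (sortedEigenvalue hA) :=
  fun _ _ hij => hA.eigenvalues₀_antitone (by simpa using hij)

lemma exists_sorted_eigenbasis (hA : A.IsHermitian) :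
    ∃ u : OrthonormalBasis (Fin d) ℝ (EuclideanSpace ℝ (Fin d)),
      ∀ i, A.mulVec (u i).ofLp = sortedEigenvalue hA i • (u i).ofLp := by
  have hT := Matrix.isSymmetric_toEuclideanLin_iff.2 hA
  refine ⟨(hT.eigenvectorBasis finrank_euclideanSpace).reindex
    (finCongr (Fintype.card_fin d)), fun i => toEuclideanLin_eq_smul_iff.1 ?_⟩
  rw [OrthonormalBasis.reindex_apply]
  exact hT.apply_eigenvectorBasis finrank_euclideanSpace _

lemma roots_charpoly_of_eigenbasis
    {u : OrthonormalBasis (Fin d) ℝ (EuclideanSpace ℝ (Fin d))} {k : Fin d → ℝ}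
    (h : ∀ i, A.mulVec (u i).ofLp = k i • (u i).ofLp) :
    A.charpoly.roots = Multiset.map k Finset.univ.val := by
  have h1 : LinearMap.toMatrix u.toBasis u.toBasis (Matrix.toEuclideanLin A)
      = Matrix.diagonal k := by
    ext i j
    rw [LinearMap.toMatrix_apply, OrthonormalBasis.coe_toBasis,
      toEuclideanLin_eq_smul_iff.2 (h j), map_smul, ← OrthonormalBasis.coe_toBasis,
      Module.Basis.repr_self, Finsupp.smul_apply, Finsupp.single_apply, Matrix.diagonal_apply]
    by_cases hij : i = j
    · simp [hij]
    · simp [hij, Ne.symm hij]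
  have h2 : LinearMap.toMatrix (EuclideanSpace.basisFun (Fin d) ℝ).toBasis
      (EuclideanSpace.basisFun (Fin d) ℝ).toBasis (Matrix.toEuclideanLin A) = A := by
    rw [Matrix.toEuclideanLin_eq_toLin_orthonormal, LinearMap.toMatrix_toLin]
  have h3 : A.charpoly = ∏ i, (Polynomial.X - Polynomial.C (k i)) := by
    rw [← Matrix.charpoly_diagonal, ← h1, LinearMap.charpoly_toMatrix]
    conv_lhs => rw [← h2]
    rw [LinearMap.charpoly_toMatrix]
  have h4 := Polynomial.roots_multiset_prod_X_sub_C (Multiset.map k Finset.univ.val)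
  rw [Multiset.map_map] at h4
  rw [h3, Finset.prod_eq_multiset_prod]
  exact h4

/-- Eigenvalues listed in decreasing order along any orthonormal eigenbasis are the sorted
eigenvalues. -/
lemma sortedEigenvalue_eq_of_antitone (hA : A.IsHermitian)
    {u : OrthonormalBasis (Fin d) ℝ (EuclideanSpace ℝ (Fin d))} {k : Fin d → ℝ}
    (h : ∀ i, A.mulVec (u i).ofLp = k i • (u i).ofLp) (hk : Antitone k) (i : Fin d) :
    sortedEigenvalue hA i = k i := by
  obtain ⟨w, hw⟩ := exists_sorted_eigenbasis hA
  have h1 := roots_charpoly_of_eigenbasis h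
  rw [roots_charpoly_of_eigenbasis hw, Fin.univ_val_map, Fin.univ_val_map] at h1
  have h2 := List.Perm.eq_of_sortedGE (sortedEigenvalue_antitone hA).sortedGE_ofFn
    hk.sortedGE_ofFn (Multiset.coe_eq_coe.1 h1)
  exact congrFun (List.ofFn_injective h2) i

lemma rank_eq_card_of_eigenbasis (hA : A.IsHermitian)
    {u : OrthonormalBasis (Fin d) ℝ (EuclideanSpace ℝ (Fin d))} {k : Fin d → ℝ}
    (h : ∀ i, A.mulVec (u i).ofLp = k i • (u i).ofLp) :
    A.rank = (Finset.univ.filter fun i => k i ≠ 0).card := by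
  have h1 := hA.roots_charpoly_eq_eigenvalues
  rw [roots_charpoly_of_eigenbasis h] at h1
  have h2 := congrArg (Multiset.countP (· ≠ (0 : ℝ))) h1
  rw [Multiset.countP_map, Multiset.countP_map] at h2
  rw [hA.rank_eq_card_non_zero_eigs, Fintype.card_subtype]
  exact h2.symm

lemma eigenvalue_nonneg_of_eigenbasis (hA : A.PosSemidef)
    {u : OrthonormalBasis (Fin d) ℝ (EuclideanSpace ℝ (Fin d))} {k : Fin d → ℝ}
    (h : ∀ i, A.mulVec (u i).ofLp = k i • (u i).ofLp) (i : Fin d) : 0 ≤ k i := by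
  have h0 := hA.dotProduct_mulVec_nonneg (u i).ofLp
  rw [h i, dotProduct_smul, smul_eq_mul] at h0
  have h1 : star (u i).ofLp ⬝ᵥ (u i).ofLp = 1 := by
    rw [dotProduct_comm, ← EuclideanSpace.inner_eq_star_dotProduct, real_inner_self_eq_norm_sq,
      u.norm_eq_one, one_pow]
  rwa [h1, mul_one] at h0

lemma sortedEigenvalue_nonneg (hA : A.PosSemidef) (i : Fin d) :
    0 ≤ sortedEigenvalue hA.isHermitian i := by
  obtain ⟨u, hu⟩ := exists_sorted_eigenbasis hA.isHermitian
  exact eigenvalue_nonneg_of_eigenbasis hA hu i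

/-- The nonzero entries of a decreasing nonnegative family come first. -/
lemma val_lt_card_ne_zero_of_antitone {k : Fin d → ℝ} (hk : Antitone k) (h0 : ∀ i, 0 ≤ k i)
    {i : Fin d} (hi : k i ≠ 0) : i.val < (Finset.univ.filter fun j => k j ≠ 0).card := by
  have hsub : Finset.Iic i ⊆ Finset.univ.filter fun j => k j ≠ 0 := by
    intro j hj
    have := hk (Finset.mem_Iic.1 hj)
    have h1 := lt_of_le_of_ne (h0 i) hi.symm
    simp only [Finset.mem_filter, Finset.mem_univ, true_and]
    linarith
  have := Finset.card_le_card hsub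
  rw [Fin.card_Iic] at this
  omega

/-- Commuting symmetric matrices have a common orthonormal eigenbasis. -/
lemma exists_common_eigenbasis (hA : A.IsHermitian) (hB : B.IsHermitian) (hAB : Commute A B) :
    ∃ (v : OrthonormalBasis (Fin d) ℝ (EuclideanSpace ℝ (Fin d))) (k l : Fin d → ℝ),
      (∀ i, A.mulVec (v i).ofLp = k i • (v i).ofLp) ∧
      (∀ i, B.mulVec (v i).ofLp = l i • (v i).ofLp) := by
  have hSA := Matrix.isSymmetric_toEuclideanLin_iff.2 hA
  have hSB := Matrix.isSymmetric_toEuclideanLin_iff.2 hB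
  have hcomm : Commute (Matrix.toEuclideanLin A) (Matrix.toEuclideanLin B) := by
    refine LinearMap.ext fun x => ?_
    change WithLp.toLp 2 (A.mulVec (B.mulVec x.ofLp)) = WithLp.toLp 2 (B.mulVec (A.mulVec x.ofLp))
    rw [Matrix.mulVec_mulVec, Matrix.mulVec_mulVec, hAB.eq]
  have hint := LinearMap.IsSymmetric.directSum_isInternal_of_commute hSA hSB hcomm
  have horth := LinearMap.IsSymmetric.orthogonalFamily_eigenspace_inf_eigenspace hSA hSB
  -- all but finitely many of the joint eigenspaces are zero
  have hint' := DirectSum.isInternal_ne_bot_iff.2 hint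
  have hfin : Finite {i : ℝ × ℝ // (Module.End.eigenspace (Matrix.toEuclideanLin A) i.2 ⊓
      Module.End.eigenspace (Matrix.toEuclideanLin B) i.1) ≠ ⊥} :=
    (WellFoundedGT.finite_ne_bot_of_iSupIndep hint.submodule_iSupIndep).to_subtype
  have := Fintype.ofFinite {i : ℝ × ℝ // (Module.End.eigenspace (Matrix.toEuclideanLin A) i.2 ⊓
      Module.End.eigenspace (Matrix.toEuclideanLin B) i.1) ≠ ⊥}
  have horth' := horth.comp (γ := {i : ℝ × ℝ // (Module.End.eigenspace (Matrix.toEuclideanLin A) i.2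
    ⊓ Module.End.eigenspace (Matrix.toEuclideanLin B) i.1) ≠ ⊥}) Subtype.val_injective
  have hd : Module.finrank ℝ (EuclideanSpace ℝ (Fin d)) = d := by simp
  have hmem := fun i => hint'.subordinateOrthonormalBasis_subordinate hd i horth'
  refine ⟨hint'.subordinateOrthonormalBasis hd horth',
    fun i => (hint'.subordinateOrthonormalBasisIndex hd i horth').1.2,
    fun i => (hint'.subordinateOrthonormalBasisIndex hd i horth').1.1, fun i => ?_, fun i => ?_⟩
  · exact toEuclideanLin_eq_smul_iff.1 (Module.End.mem_eigenspace_iff.1 (hmem i).1)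
  · exact toEuclideanLin_eq_smul_iff.1 (Module.End.mem_eigenspace_iff.1 (hmem i).2)

/-- A common eigenbasis can be ordered so that the sums of the two eigenvalues decrease. -/
lemma exists_common_eigenbasis_antitone_add (hA : A.IsHermitian) (hB : B.IsHermitian)
    (hAB : Commute A B) :
    ∃ (v : OrthonormalBasis (Fin d) ℝ (EuclideanSpace ℝ (Fin d))) (k l : Fin d → ℝ),
      (∀ i, A.mulVec (v i).ofLp = k i • (v i).ofLp) ∧
      (∀ i, B.mulVec (v i).ofLp = l i • (v i).ofLp) ∧ Antitone (fun i => k i + l i) := by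
  obtain ⟨v, k, l, hk, hl⟩ := exists_common_eigenbasis hA hB hAB
  let σ := Tuple.sort fun i => -(k i + l i)
  refine ⟨v.reindex σ.symm, k ∘ σ, l ∘ σ, fun i => ?_, fun i => ?_, fun i j hij => ?_⟩
  · simpa using hk (σ i)
  · simpa using hl (σ i)
  · have := Tuple.monotone_sort (fun i => -(k i + l i)) hij
    exact neg_le_neg_iff.1 this

end Eigenbasis

/-! ### A trace inequality of Ky Fan type for the gain -/

section KyFan

variable {d r : ℕ}

/-- A weighted sum of a decreasing family with weights in `[0, 1]` of total at most `r` is at most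
the sum of its first `r` terms. -/
lemma sum_mul_le_sum_filter_lt {g c : Fin d → ℝ} (hg : Antitone g) (hg0 : ∀ i, 0 ≤ g i)
    (hc0 : ∀ i, 0 ≤ c i) (hc1 : ∀ i, c i ≤ 1) (hc : ∑ i, c i ≤ r) :
    ∑ i, c i * g i ≤ ∑ i with i.val < r, g i := by
  -- `γ` separates the first `r` terms from the others
  obtain ⟨γ, h1, h2, h3⟩ : ∃ γ : ℝ, (∀ i : Fin d, i.val < r → γ ≤ g i) ∧
      (∀ i : Fin d, ¬ i.val < r → g i ≤ γ) ∧
      (∑ i, c i) * γ ≤ (∑ i : Fin d, if i.val < r then (1 : ℝ) else 0) * γ := by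
    by_cases hrd : r < d
    · refine ⟨g ⟨r, hrd⟩, fun i hi => hg (Fin.mk_le_mk.2 hi.le), fun i hi =>
        hg (Fin.mk_le_mk.2 (not_lt.1 hi)), mul_le_mul_of_nonneg_right ?_ (hg0 _)⟩
      rw [Finset.sum_boole]
      refine hc.trans (Nat.cast_le.2 ?_)
      have : (Finset.univ.filter fun i : Fin d => i.val < r) = Finset.Iio ⟨r, hrd⟩ := by
        ext i
        simp [Fin.lt_def]
      rw [this, Fin.card_Iio]
    · exact ⟨0, fun i _ => hg0 i, fun i hi => absurd i.isLt (by omega), by simp⟩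
  rw [Finset.sum_filter]
  have key : ∀ i ∈ Finset.univ, c i * g i ≤ (if i.val < r then g i else 0)
      + (c i * γ - (if i.val < r then (1 : ℝ) else 0) * γ) := by
    intro i _
    split_ifs with hi
    · nlinarith [h1 i hi, hc1 i]
    · nlinarith [h2 i hi, hc0 i]
  refine (Finset.sum_le_sum key).trans ?_
  rw [Finset.sum_add_distrib, Finset.sum_sub_distrib, ← Finset.sum_mul, ← Finset.sum_mul]
  linarith

variable {f u : OrthonormalBasis (Fin d) ℝ (EuclideanSpace ℝ (Fin d))} {k κ : Fin d → ℝ} {t : ℝ}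

/-- Jensen's inequality for the gain of a weighted mean of eigenvalues. -/
lemma gain_le_sum (ht : 0 < t) (hκ : ∀ j, κ j = ∑ i, inner ℝ (f j) (u i) ^ 2 * k i) (j : Fin d) :
    gain t (κ j) ≤ ∑ i, inner ℝ (f j) (u i) ^ 2 * gain t (k i) ∧
    (t < κ j → (∃ i, inner ℝ (f j) (u i) ≠ (0 : ℝ) ∧ k i ≠ κ j) →
      gain t (κ j) < ∑ i, inner ℝ (f j) (u i) ^ 2 * gain t (k i)) := by
  have hw : ∑ i, inner ℝ (f j) (u i) ^ 2 = (1 : ℝ) := by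
    rw [u.sum_sq_inner_left, f.norm_eq_one, one_pow]
  rcases le_or_gt (κ j) t with h | h
  · refine ⟨?_, fun h' => absurd h' h.not_gt⟩
    rw [gain_of_le h]
    exact Finset.sum_nonneg fun i _ => mul_nonneg (sq_nonneg _) (gain_nonneg ht _)
  · have hline : gain t (κ j) = ∑ i, inner ℝ (f j) (u i) ^ 2
        * (gain t (κ j) + (1 - t / κ j) * (k i - κ j)) := by
      have : ∀ i, inner ℝ (f j) (u i) ^ 2 * (gain t (κ j) + (1 - t / κ j) * (k i - κ j))
          = inner ℝ (f j) (u i) ^ 2 * (gain t (κ j) - (1 - t / κ j) * κ j)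
            + (1 - t / κ j) * (inner ℝ (f j) (u i) ^ 2 * k i) := fun i => by ring
      simp_rw [this]
      rw [Finset.sum_add_distrib, ← Finset.sum_mul, hw, ← Finset.mul_sum, ← hκ]
      ring
    have hle : ∀ i, gain t (κ j) + (1 - t / κ j) * (k i - κ j) ≤ gain t (k i) := by
      intro i
      by_cases hi : k i = κ j
      · rw [hi, sub_self, mul_zero, add_zero]
      · exact (gain_tangent_lt ht h hi).le
    refine ⟨?_, fun _ ⟨i, hi, hne⟩ => ?_⟩
    · rw [hline]
      exact Finset.sum_le_sum fun i _ => mul_le_mul_of_nonneg_left (hle i) (sq_nonneg _)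
    · rw [hline]
      refine Finset.sum_lt_sum (fun i _ => mul_le_mul_of_nonneg_left (hle i) (sq_nonneg _))
        ⟨i, Finset.mem_univ _, mul_lt_mul_of_pos_left (gain_tangent_lt ht h hne) ?_⟩
      positivity

lemma sum_sum_gain_le (ht : 0 < t) (hk : Antitone k) {S : Finset (Fin d)} (hS : S.card ≤ r) :
    ∑ j ∈ S, ∑ i, inner ℝ (f j) (u i) ^ 2 * gain t (k i) ≤ ∑ i with i.val < r, gain t (k i) := by
  rw [Finset.sum_comm]
  simp_rw [← Finset.sum_mul]
  refine sum_mul_le_sum_filter_lt (fun i j hij => gain_mono ht (hk hij))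
    (fun i => gain_nonneg ht _) (fun i => Finset.sum_nonneg fun j _ => sq_nonneg _)
    (fun i => ?_) ?_
  · refine (Finset.sum_le_univ_sum_of_nonneg fun j => sq_nonneg _).trans (le_of_eq ?_)
    rw [f.sum_sq_inner_right, u.norm_eq_one, one_pow]
  · rw [Finset.sum_comm]
    simp_rw [u.sum_sq_inner_left, f.norm_eq_one, one_pow]
    simpa using hS

/-- At most `r` orthonormal directions gain at most as much as the top `r` eigendirections. -/
lemma sum_gain_le (ht : 0 < t) (hk : Antitone k)
    (hκ : ∀ j, κ j = ∑ i, inner ℝ (f j) (u i) ^ 2 * k i) {S : Finset (Fin d)} (hS : S.card ≤ r) :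
    ∑ j ∈ S, gain t (κ j) ≤ ∑ i with i.val < r, gain t (k i) :=
  (Finset.sum_le_sum fun j _ => (gain_le_sum ht hκ j).1).trans (sum_sum_gain_le ht hk hS)

/-- In the equality case of `sum_gain_le`, a direction whose moment exceeds the threshold only
charges the eigenspace of that moment. -/
lemma eq_of_sum_gain_le (ht : 0 < t) (hk : Antitone k)
    (hκ : ∀ j, κ j = ∑ i, inner ℝ (f j) (u i) ^ 2 * k i) {S : Finset (Fin d)} (hS : S.card ≤ r)
    (heq : ∑ i with i.val < r, gain t (k i) ≤ ∑ j ∈ S, gain t (κ j)) {j : Fin d} (hj : j ∈ S)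
    (hjt : t < κ j) (i : Fin d) (hi : inner ℝ (f j) (u i) ≠ (0 : ℝ)) : k i = κ j := by
  by_contra hne
  have := Finset.sum_lt_sum (fun j _ => (gain_le_sum ht hκ j).1)
    ⟨j, hj, (gain_le_sum ht hκ j).2 hjt ⟨i, hi, hne⟩⟩
  have := sum_sum_gain_le (f := f) (u := u) ht hk hS
  linarith

end KyFan

/-! ### The optimal value -/

section OptimalValue

variable {d r : ℕ} {K : Matrix (Fin d) (Fin d) ℝ} {t : ℝ}
  {u f : OrthonormalBasis (Fin d) ℝ (EuclideanSpace ℝ (Fin d))}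

/-- The optimal value of the entropic W2GAN problem with regularization `2 t`: the trace of `K`
minus the gains of its top `r` eigenvalues. -/
noncomputable def optimalValue (hK : K.IsHermitian) (t : ℝ) (r : ℕ) : ℝ :=
  ∑ i, sortedEigenvalue hK i - ∑ i with i.val < r, gain t (sortedEigenvalue hK i)

/-- Nonnegativity ensures that comparing the costs in `[0, ∞]` loses nothing to the truncation in
`ENNReal.ofReal`. -/
lemma optimalValue_nonneg (hK : K.PosSemidef) (ht : 0 < t) :
    0 ≤ optimalValue hK.isHermitian t r := by
  rw [optimalValue, Finset.sum_filter, ← Finset.sum_sub_distrib]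
  refine Finset.sum_nonneg fun i _ => ?_
  have h0 := sortedEigenvalue_nonneg hK i
  have := gain_le_self ht h0
  split_ifs <;> linarith

lemma directionalMoment_multivariateGaussian (hK : K.PosSemidef) {k : Fin d → ℝ}
    (hu : ∀ i, K.mulVec (u i).ofLp = k i • (u i).ofLp) (v : EuclideanSpace ℝ (Fin d)) :
    directionalMoment (multivariateGaussian 0 K) v = ∑ i, inner ℝ v (u i) ^ 2 * k i :=
  directionalMoment_eq_sum integral_id_multivariateGaussian
    (by simpa only [covarianceMatrix_multivariateGaussian hK] using hu) v

lemma directionalMoment_eigenvector (hK : K.PosSemidef) {k : Fin d → ℝ}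
    (hu : ∀ i, K.mulVec (u i).ofLp = k i • (u i).ofLp) (i : Fin d) :
    directionalMoment (multivariateGaussian 0 K) (u i) = k i := by
  rw [directionalMoment_multivariateGaussian hK hu]
  simp [u.inner_eq_ite]

lemma dualValue_eq_sum_add (hK : K.PosSemidef) (a : Fin d → ℝ) :
    dualValue t f a (multivariateGaussian 0 K) = ∑ i, sortedEigenvalue hK.isHermitian i
      + ∑ i, scalarCost t (a i) (directionalMoment (multivariateGaussian 0 K) (f i)) := by
  obtain ⟨u, hu⟩ := exists_sorted_eigenbasis hK.isHermitian
  rw [dualValue, Finset.sum_add_distrib]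
  congr 1
  simp_rw [directionalMoment_multivariateGaussian hK hu]
  rw [Finset.sum_comm]
  simp_rw [← Finset.sum_mul, f.sum_sq_inner_right, u.norm_eq_one, one_pow, one_mul]

/-- The dual value is bounded below by the gains of the directions charged by the generated law. -/
lemma sub_sum_gain_le_dualValue (hK : K.PosSemidef) (ht : 0 < t) {a : Fin d → ℝ}
    (ha : ∀ i, 0 ≤ a i) :
    ∑ i, sortedEigenvalue hK.isHermitian i - ∑ i with a i ≠ 0,
      gain t (directionalMoment (multivariateGaussian 0 K) (f i))
      ≤ dualValue t f a (multivariateGaussian 0 K) := by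
  rw [dualValue_eq_sum_add hK, Finset.sum_filter, sub_eq_add_neg, ← Finset.sum_neg_distrib]
  gcongr with i
  split_ifs with hi
  · exact neg_gain_le_scalarCost _ ht (ha i)
  · rw [not_not.1 hi, scalarCost_zero, neg_zero]

lemma optimalValue_le_dualValue (hK : K.PosSemidef) (ht : 0 < t) {a : Fin d → ℝ}
    (ha : ∀ i, 0 ≤ a i) (hr : (Finset.univ.filter fun i => a i ≠ 0).card ≤ r) :
    optimalValue hK.isHermitian t r ≤ dualValue t f a (multivariateGaussian 0 K) := by
  obtain ⟨u, hu⟩ := exists_sorted_eigenbasis hK.isHermitian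
  have h1 := sub_sum_gain_le_dualValue (f := f) hK ht ha
  have h2 := sum_gain_le ht (sortedEigenvalue_antitone hK.isHermitian)
    (fun j => directionalMoment_multivariateGaussian hK hu (f j)) hr
  rw [optimalValue]
  linarith

/-- A generated law whose dual value is optimal charges only eigendirections of `K`, with the
eigenvalue reduced by `t`. -/
lemma mulVec_eq_of_dualValue_le (hK : K.PosSemidef) (ht : 0 < t) {a : Fin d → ℝ}
    (ha : ∀ i, 0 ≤ a i) (hr : (Finset.univ.filter fun i => a i ≠ 0).card ≤ r)
    (hle : dualValue t f a (multivariateGaussian 0 K) ≤ optimalValue hK.isHermitian t r)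
    {j : Fin d} (hj : a j ≠ 0) :
    K.mulVec (f j).ofLp = (a j + t) • (f j).ofLp := by
  obtain ⟨u, hu⟩ := exists_sorted_eigenbasis hK.isHermitian
  have hanti := sortedEigenvalue_antitone hK.isHermitian
  set κ := fun j => directionalMoment (multivariateGaussian 0 K) (f j) with hκdef
  have hκ : ∀ j, κ j = ∑ i, inner ℝ (f j) (u i) ^ 2 * sortedEigenvalue hK.isHermitian i :=
    fun j => directionalMoment_multivariateGaussian hK hu (f j)
  have hkf := sum_gain_le ht hanti hκ hr
  -- a variance other than the soft-thresholded one would make the dual value too large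
  have haj : a j = κ j - t := by
    have hmax : a j = max (κ j - t) 0 := by
      by_contra hne
      have hlt : ∑ i, (if a i ≠ 0 then -gain t (κ i) else 0) < ∑ i, scalarCost t (a i) (κ i) := by
        refine Finset.sum_lt_sum (fun i _ => ?_) ⟨j, Finset.mem_univ _, ?_⟩
        · split_ifs with hi
          · exact neg_gain_le_scalarCost _ ht (ha i)
          · rw [not_not.1 hi, scalarCost_zero]
        · rw [if_pos hj]
          exact neg_gain_lt_scalarCost ht (ha j) hne
      rw [dualValue_eq_sum_add hK, optimalValue] at hle
      rw [← Finset.sum_filter, Finset.sum_neg_distrib] at hlt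
      linarith
    rcases max_choice (κ j - t) 0 with h | h
    · rw [hmax, h]
    · exact absurd (hmax.trans h) hj
  have hjt : t < κ j := by
    have := lt_of_le_of_ne (ha j) hj.symm
    linarith
  have h1 := sub_sum_gain_le_dualValue (f := f) hK ht ha
  rw [optimalValue] at hle
  have heq := eq_of_sum_gain_le ht hanti hκ hr (by linarith)
    (Finset.mem_filter.2 ⟨Finset.mem_univ j, hj⟩) hjt
  rw [show a j + t = κ j by linarith]
  refine toEuclideanLin_eq_smul_iff.1 ?_
  conv_lhs => rw [← u.sum_repr' (f j)]
  conv_rhs => rw [← u.sum_repr' (f j)]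
  rw [map_sum, Finset.smul_sum]
  refine Finset.sum_congr rfl fun i _ => ?_
  rw [map_smul, toEuclideanLin_eq_smul_iff.2 (hu i), smul_smul, smul_smul, real_inner_comm]
  by_cases hi : inner ℝ (f j) (u i) = (0 : ℝ)
  · rw [hi, zero_mul, mul_zero]
  · rw [heq i hi, mul_comm]

/-- The weak duality bound in an eigenbasis of the covariance matrix of the generated law. -/
lemma dualValue_le_entropicW2Sq_generatedLaw (ht : 0 < t) (G : Matrix (Fin d) (Fin r) ℝ)
    {a : Fin d → ℝ}
    (ha : ∀ i, (covarianceMatrix (generatedLaw G)).mulVec (f i).ofLp = a i • (f i).ofLp) :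
    ENNReal.ofReal (dualValue t f a (multivariateGaussian 0 K))
      ≤ entropicW2Sq (2 * t) (generatedLaw G) (multivariateGaussian 0 K) :=
  (isDiagonalGaussian_of_eigenbasis (integral_id_generatedLaw G) ha).dualValue_le_entropicW2Sq ht
    (eigenvalue_nonneg_of_eigenbasis (posSemidef_covarianceMatrix_generatedLaw G) ha)
    IsGaussian.memLp_two_id IsGaussian.memLp_two_id

lemma card_eigenvalue_ne_zero_generatedLaw_le (G : Matrix (Fin d) (Fin r) ℝ) {a : Fin d → ℝ}
    (ha : ∀ i, (covarianceMatrix (generatedLaw G)).mulVec (f i).ofLp = a i • (f i).ofLp) :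
    (Finset.univ.filter fun i => a i ≠ 0).card ≤ r := by
  rw [← rank_eq_card_of_eigenbasis (covarianceMatrix_isHermitian _) ha]
  exact rank_covarianceMatrix_generatedLaw_le G

lemma optimalValue_le_entropicW2Sq (hK : K.PosSemidef) (ht : 0 < t)
    (G : Matrix (Fin d) (Fin r) ℝ) :
    ENNReal.ofReal (optimalValue hK.isHermitian t r)
      ≤ entropicW2Sq (2 * t) (generatedLaw G) (multivariateGaussian 0 K) := by
  obtain ⟨f, hf⟩ := exists_sorted_eigenbasis (covarianceMatrix_isHermitian (generatedLaw G))
  refine le_trans (ENNReal.ofReal_le_ofReal (optimalValue_le_dualValue (f := f) hK ht ?_ ?_))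
    (dualValue_le_entropicW2Sq_generatedLaw ht G hf)
  · exact eigenvalue_nonneg_of_eigenbasis (posSemidef_covarianceMatrix_generatedLaw G) hf
  · exact card_eigenvalue_ne_zero_generatedLaw_le G hf

/-! ### Soft-thresholded principal component analysis -/

lemma IsSoftThresholdedPCA.sortedEigenvalue_ne_zero_iff {L : Matrix (Fin d) (Fin d) ℝ}
    {hK : K.IsHermitian} (hL : L.PosSemidef)
    (h : IsSoftThresholdedPCA r t hK hL.isHermitian) (i : Fin d) :
    sortedEigenvalue hL.isHermitian i ≠ 0 ↔ i.val < r ∧ t < sortedEigenvalue hK i := by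
  obtain ⟨u, -, hu⟩ := h.eigenvectors
  constructor
  · intro hi
    have hir : i.val < r := by
      refine (val_lt_card_ne_zero_of_antitone (sortedEigenvalue_antitone hL.isHermitian)
        (sortedEigenvalue_nonneg hL) hi).trans_le ?_
      rw [← rank_eq_card_of_eigenbasis hL.isHermitian hu]
      exact h.rank_le
    refine ⟨hir, ?_⟩
    by_contra hlt
    rw [h.eigenvalues i hir, max_eq_right (by linarith)] at hi
    exact hi rfl
  · rintro ⟨hir, hlt⟩
    rw [h.eigenvalues i hir, max_eq_left (by linarith)]
    linarith

lemma IsSoftThresholdedPCA.rank_eq {L : Matrix (Fin d) (Fin d) ℝ}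
    {hK : K.IsHermitian} (hL : L.PosSemidef)
    (h : IsSoftThresholdedPCA r t hK hL.isHermitian) :
    L.rank = {i : Fin d | i.val < r ∧ t < sortedEigenvalue hK i}.ncard := by
  obtain ⟨u, -, hu⟩ := h.eigenvectors
  rw [rank_eq_card_of_eigenbasis hL.isHermitian hu, ← Set.ncard_coe_finset]
  congr 1
  ext i
  simpa using h.sortedEigenvalue_ne_zero_iff hL i

lemma IsSoftThresholdedPCA.entropicW2Sq_le (hK : K.PosSemidef) (ht : 0 < t)
    {G : Matrix (Fin d) (Fin r) ℝ} (h : IsSoftThresholdedPCA r t hK.isHermitian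
      (posSemidef_covarianceMatrix_generatedLaw G).isHermitian) :
    entropicW2Sq (2 * t) (generatedLaw G) (multivariateGaussian 0 K)
      ≤ ENNReal.ofReal (optimalValue hK.isHermitian t r) := by
  obtain ⟨u, hu, ha⟩ := h.eigenvectors
  have hP := isDiagonalGaussian_of_eigenbasis (integral_id_generatedLaw G) ha
  have hQ := isDiagonalGaussian_of_eigenbasis (P := multivariateGaussian 0 K) (f := u)
    integral_id_multivariateGaussian (by rwa [covarianceMatrix_multivariateGaussian hK])
  refine (hP.entropicW2Sq_le_dualValue ht
    (sortedEigenvalue_nonneg (posSemidef_covarianceMatrix_generatedLaw G)) hQ (fun i hi => ?_)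
    IsGaussian.memLp_two_id IsGaussian.memLp_two_id).trans (le_of_eq ?_)
  · obtain ⟨hir, hlt⟩ :=
      (h.sortedEigenvalue_ne_zero_iff (posSemidef_covarianceMatrix_generatedLaw G) i).1 hi
    rw [h.eigenvalues i hir, max_eq_left (by linarith), sub_add_cancel]
  · rw [dualValue_eq_sum_add hK, optimalValue, sub_eq_add_neg, Finset.sum_filter,
      ← Finset.sum_neg_distrib]
    congr 2
    refine Finset.sum_congr rfl fun i _ => ?_
    rw [directionalMoment_eigenvector hK hu]
    split_ifs with hir
    · rw [h.eigenvalues i hir, scalarCost_softThreshold ht]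
    · have := mt
        (h.sortedEigenvalue_ne_zero_iff (posSemidef_covarianceMatrix_generatedLaw G) i).1
        fun h' => hir h'.1
      rw [not_not.1 this, scalarCost_zero, neg_zero]

/-- The matrix with columns `√(λ_j - t)_+ u_j`, `j < r`, generates a law whose covariance matrix is
a soft-thresholded PCA. -/
lemma exists_isSoftThresholdedPCA (hr : r ≤ d) (hK : K.IsHermitian) (t : ℝ) :
    ∃ G : Matrix (Fin d) (Fin r) ℝ, IsSoftThresholdedPCA r t hK
      (posSemidef_covarianceMatrix_generatedLaw G).isHermitian := by
  obtain ⟨u, hu⟩ := exists_sorted_eigenbasis hK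
  let m : Fin d → ℝ := fun i => max (sortedEigenvalue hK i - t) 0
  let s : Fin d → ℝ := fun i => if i.val < r then m i else 0
  let G : Matrix (Fin d) (Fin r) ℝ :=
    Matrix.of fun i j => √(m (Fin.castLE hr j)) * u (Fin.castLE hr j) i
  have hm : Antitone m := fun i j hij =>
    max_le_max (by linarith [sortedEigenvalue_antitone hK hij]) le_rfl
  have hm0 : ∀ i, 0 ≤ m i := fun i => le_max_right _ _
  have hs : Antitone s := by
    intro i j hij
    simp only [s]
    have hij' : i.val ≤ j.val := hij
    split_ifs with h1 h2
    · exact hm hij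
    · omega
    · exact hm0 i
    · exact le_rfl
  have hL : ∀ i, (covarianceMatrix (generatedLaw G)).mulVec (u i).ofLp = s i • (u i).ofLp := by
    intro i
    have hin : ∀ j, ∑ l, u (Fin.castLE hr j) l * u i l
        = if Fin.castLE hr j = i then (1 : ℝ) else 0 := by
      intro j
      have := u.inner_eq_ite i (Fin.castLE hr j)
      rw [PiLp.inner_apply] at this
      simp only [RCLike.inner_apply, conj_trivial] at this
      rw [this]
      simp only [eq_comm]
    have hGt : G.transpose.mulVec (u i).ofLp = fun j =>
        √(m (Fin.castLE hr j)) * if Fin.castLE hr j = i then (1 : ℝ) else 0 := by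
      ext j
      simp only [Matrix.mulVec, dotProduct]
      rw [← hin j, Finset.mul_sum]
      refine Finset.sum_congr rfl fun l _ => ?_
      simp only [G, Matrix.transpose_apply, Matrix.of_apply]
      ring
    rw [covarianceMatrix_generatedLaw, ← Matrix.mulVec_mulVec, hGt]
    ext l
    simp only [Matrix.mulVec, dotProduct, G, Matrix.of_apply, Pi.smul_apply, smul_eq_mul, s]
    split_ifs with hi
    · rw [Finset.sum_eq_single (⟨i.val, hi⟩ : Fin r)]
      · have hcast : Fin.castLE hr ⟨i.val, hi⟩ = i := rfl
        rw [hcast, if_pos rfl, mul_one, mul_right_comm, Real.mul_self_sqrt (hm0 i)]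
      · intro j _ hj
        have hne : Fin.castLE hr j ≠ i := by
          rintro rfl
          exact hj rfl
        rw [if_neg hne, mul_zero, mul_zero]
      · simp
    · rw [zero_mul]
      refine Finset.sum_eq_zero fun j _ => ?_
      have hne : Fin.castLE hr j ≠ i := fun h => hi (by rw [← h]; exact j.isLt)
      rw [if_neg hne, mul_zero, mul_zero]
  have hsort := sortedEigenvalue_eq_of_antitone
    (posSemidef_covarianceMatrix_generatedLaw G).isHermitian hL hs
  refine ⟨G, rank_covarianceMatrix_generatedLaw_le G, ⟨u, hu, fun i => ?_⟩, fun i hi => ?_⟩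
  · rw [hsort, hL]
  · rw [hsort]
    exact if_pos hi

/-- The covariance matrix of an optimal generator commutes with `K`: on its range, `K` is the
covariance matrix shifted by `t`. -/
lemma commute_of_entropicW2Sq_le (hK : K.PosSemidef) (ht : 0 < t)
    {G : Matrix (Fin d) (Fin r) ℝ}
    (hle : entropicW2Sq (2 * t) (generatedLaw G) (multivariateGaussian 0 K)
      ≤ ENNReal.ofReal (optimalValue hK.isHermitian t r)) :
    Commute K (covarianceMatrix (generatedLaw G)) := by
  set L := covarianceMatrix (generatedLaw G) with hLdef
  have hL : L.PosSemidef := posSemidef_covarianceMatrix_generatedLaw G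
  obtain ⟨f, hf⟩ := exists_sorted_eigenbasis hL.isHermitian
  have hdual := (ENNReal.ofReal_le_ofReal_iff (optimalValue_nonneg hK ht)).1
    ((dualValue_le_entropicW2Sq_generatedLaw (K := K) ht G hf).trans hle)
  have hKL : K * L = L * L + t • L := by
    refine Matrix.toEuclideanLin.injective (f.toBasis.ext fun j => ?_)
    rw [OrthonormalBasis.coe_toBasis]
    change WithLp.toLp 2 ((K * L).mulVec (f j).ofLp)
      = WithLp.toLp 2 ((L * L + t • L).mulVec (f j).ofLp)
    rw [Matrix.add_mulVec, Matrix.smul_mulVec, ← Matrix.mulVec_mulVec, ← Matrix.mulVec_mulVec,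
      hf j, Matrix.mulVec_smul, Matrix.mulVec_smul, hf j]
    by_cases hj : sortedEigenvalue hL.isHermitian j = 0
    · simp [hj]
    · rw [mulVec_eq_of_dualValue_le hK ht (sortedEigenvalue_nonneg hL)
        (card_eigenvalue_ne_zero_generatedLaw_le G hf) hdual hj, smul_smul, smul_smul, smul_smul,
        ← add_smul]
      congr 2
      ring
  -- the right-hand side of `hKL` is symmetric, so `K * L` equals its transpose `L * K`
  have hLK := congrArg Matrix.conjTranspose hKL
  rw [Matrix.conjTranspose_mul, Matrix.conjTranspose_add, Matrix.conjTranspose_mul,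
    Matrix.conjTranspose_smul, hK.isHermitian.eq, hL.isHermitian.eq, star_trivial] at hLK
  exact hKL.trans hLK.symm

/-- Every generator that attains the optimal value performs soft-thresholded PCA. -/
lemma isSoftThresholdedPCA_of_entropicW2Sq_le (hK : K.PosSemidef) (ht : 0 < t)
    {G : Matrix (Fin d) (Fin r) ℝ}
    (hle : entropicW2Sq (2 * t) (generatedLaw G) (multivariateGaussian 0 K)
      ≤ ENNReal.ofReal (optimalValue hK.isHermitian t r)) :
    IsSoftThresholdedPCA r t hK.isHermitian
      (posSemidef_covarianceMatrix_generatedLaw G).isHermitian := by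
  have hL := posSemidef_covarianceMatrix_generatedLaw G
  obtain ⟨v, k, l, hk, hl, hkl⟩ := exists_common_eigenbasis_antitone_add hK.isHermitian
    hL.isHermitian (commute_of_entropicW2Sq_le hK ht hle)
  obtain ⟨u, hu⟩ := exists_sorted_eigenbasis hK.isHermitian
  have hdual := (ENNReal.ofReal_le_ofReal_iff (optimalValue_nonneg hK ht)).1
    ((dualValue_le_entropicW2Sq_generatedLaw (K := K) ht G hl).trans hle)
  have hl0 := eigenvalue_nonneg_of_eigenbasis hL hl
  have hcard := card_eigenvalue_ne_zero_generatedLaw_le G hl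
  have hmoment := directionalMoment_eigenvector hK hk
  set S := Finset.univ.filter fun i => l i ≠ 0 with hS
  have hmem : ∀ i, i ∈ S ↔ l i ≠ 0 := fun i => by simp [hS]
  -- on the range of the generated covariance matrix, the eigenvalues differ by `t`
  have hshift : ∀ i, l i ≠ 0 → k i = l i + t := by
    intro i hi
    have h1 := mulVec_eq_of_dualValue_le hK ht hl0 hcard hdual hi
    rw [hk i] at h1
    refine smul_left_injective ℝ (fun h0 => ?_) h1
    exact v.orthonormal.ne_zero i (congrArg (WithLp.toLp 2) h0)
  -- the set `S` of charged directions maximizes the total gain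
  have hopt : ∀ T : Finset (Fin d), T.card ≤ r →
      ∑ i ∈ T, gain t (k i) ≤ ∑ i ∈ S, gain t (k i) := by
    intro T hT
    have h1 := sum_gain_le ht (sortedEigenvalue_antitone hK.isHermitian)
      (fun j => directionalMoment_multivariateGaussian hK hu (v j)) hT
    have h2 := sub_sum_gain_le_dualValue (f := v) hK ht hl0
    simp_rw [hmoment] at h1 h2
    rw [optimalValue] at hdual
    linarith
  -- otherwise exchanging the directions `i` and `j` would increase the total gain
  have hcomono : ∀ i j, k i < k j → l i ≤ l j := by
    intro i j hij
    by_contra! hlt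
    have hi : l i ≠ 0 := ((hl0 j).trans_lt hlt).ne'
    by_cases hj : l j = 0
    · have hjS : j ∉ S.erase i := fun h => (hmem j).1 (Finset.mem_of_mem_erase h) hj
      have hiS : i ∈ S := (hmem i).2 hi
      have h1 := hopt (insert j (S.erase i)) (by
        rw [Finset.card_insert_of_notMem hjS, Finset.card_erase_add_one hiS]
        exact hcard)
      rw [Finset.sum_insert hjS, ← Finset.add_sum_erase S _ hiS] at h1
      have := gain_strictMonoOn ht (by rw [hshift i hi]; linarith [hl0 i]) hij
      linarith
    · rw [hshift i hi, hshift j hj] at hij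
      linarith
  have hkanti : Antitone k := by
    intro i j hij
    by_contra! hlt
    have h1 := hcomono i j hlt
    have h2 : k j + l j ≤ k i + l i := hkl hij
    linarith
  have hlanti : Antitone l := by
    intro i j hij
    rcases (hkanti hij).lt_or_eq with h | h
    · exact hcomono j i h
    · have h2 : k j + l j ≤ k i + l i := hkl hij
      linarith
  have hsK := sortedEigenvalue_eq_of_antitone hK.isHermitian hk hkanti
  have hsL := sortedEigenvalue_eq_of_antitone hL.isHermitian hl hlanti
  refine ⟨rank_covarianceMatrix_generatedLaw_le G, ⟨v, fun i => ?_, fun i => ?_⟩, fun i hi => ?_⟩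
  · rw [hsK, hk]
  · rw [hsL, hl]
  · rw [hsK, hsL]
    by_cases hli : l i = 0
    · -- otherwise adding the uncharged direction `i` would increase the total gain
      have hkt : k i ≤ t := by
        by_contra! hlt
        have hiS : i ∉ S := fun h => (hmem i).1 h hli
        have hcard' : S.card < r := by
          refine lt_of_le_of_lt ?_ hi
          have hsub : S ⊆ Finset.Iio i := by
            intro j hj
            rw [Finset.mem_Iio]
            by_contra! hij
            exact (hmem j).1 hj (le_antisymm ((hlanti hij).trans_eq hli) (hl0 j))
          simpa using Finset.card_le_card hsub
        have h1 := hopt (insert i S) (by rw [Finset.card_insert_of_notMem hiS]; exact hcard')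
        rw [Finset.sum_insert hiS] at h1
        have := gain_pos ht hlt
        linarith
      rw [hli, max_eq_right (by linarith)]
    · have h1 := hshift i hli
      rw [h1, add_sub_cancel_right, max_eq_left (hl0 i)]

end OptimalValue

lemma isEntropicW2GANMinimizer_iff {d r : ℕ} (hr : r ≤ d) {K : Matrix (Fin d) (Fin d) ℝ}
    (hK : K.PosSemidef) {t : ℝ} (ht : 0 < t) (G : Matrix (Fin d) (Fin r) ℝ) :
    IsEntropicW2GANMinimizer (2 * t) (multivariateGaussian 0 K) G ↔
      IsSoftThresholdedPCA r t hK.isHermitian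
        (posSemidef_covarianceMatrix_generatedLaw G).isHermitian := by
  constructor
  · intro h
    obtain ⟨G', hG'⟩ := exists_isSoftThresholdedPCA hr hK.isHermitian t
    exact isSoftThresholdedPCA_of_entropicW2Sq_le hK ht
      ((h G').trans (hG'.entropicW2Sq_le hK ht))
  · intro h G'
    exact (h.entropicW2Sq_le hK ht).trans (optimalValue_le_entropicW2Sq hK ht G')

theorem mainTheorem1 {d r : ℕ} (hr : r ≤ d) (KY : Matrix (Fin d) (Fin d) ℝ)
    (hKY : KY.PosSemidef) (lam : ℝ) (hlam : 0 < lam) :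
    (∃ G : Matrix (Fin d) (Fin r) ℝ,
      IsEntropicW2GANMinimizer lam (multivariateGaussian 0 KY) G) ∧
    (∀ G : Matrix (Fin d) (Fin r) ℝ,
      IsEntropicW2GANMinimizer lam (multivariateGaussian 0 KY) G ↔
        IsSoftThresholdedPCA r (lam / 2) hKY.isHermitian
          (covarianceMatrix_isHermitian (generatedLaw G))) ∧
    (∀ G : Matrix (Fin d) (Fin r) ℝ,
      IsEntropicW2GANMinimizer lam (multivariateGaussian 0 KY) G →
        (covarianceMatrix (generatedLaw G)).rank =
          {i : Fin d | i.val < r ∧ lam / 2 < sortedEigenvalue hKY.isHermitian i}.ncard) := by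
  have key := isEntropicW2GANMinimizer_iff hr hKY (half_pos hlam)
  rw [mul_div_cancel₀ lam two_ne_zero] at key
  obtain ⟨G, hG⟩ := exists_isSoftThresholdedPCA hr hKY.isHermitian (lam / 2)
  exact ⟨⟨G, (key G).2 hG⟩, key, fun G hG =>
    ((key G).1 hG).rank_eq (posSemidef_covarianceMatrix_generatedLaw G)⟩
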